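/- **Setting.** Let $\mathcal S,\mathcal A$ be finite and nonempty, and consider an MDP with transition kernel $\mathsf P(s'|s,a)$, reward $r(s,a)$ and discount factor $\gamma\in(0,1)$, a target policy $\pi$, a behavior policy $\mu$, features $\phi(s)\in\mathbb R^d$ whose matrix $\Phi$ (with rows $\phi(s)^\top$) has linearly independent columns, and $\lambda\in[0,1]$. Put $\rho(s,a)=\pi(a|s)/\mu(a|s)$ (with $0/0=0$), $\rho_{\max}=\max_{s,a}\rho(s,a)$, $r_{\max}=\max_{s,a}|r(s,a)|$, $r_\pi(s)=\sum_a\pi(a|s)r(s,a)$, $P_\pi(s,s')=\sum_a\pi(a|s)\mathsf P(s'|s,a)$, and likewise $P_\mu$. Assume that $\pi(a|s)>0$ implies $\mu(a|s)>0$, and that the chain with transition matrix $P_\mu$ is irreducible and aperiodic. Then there is a unique stationary distribution $d_\mu$ of $P_\mu$, and there are $C_M\ge0$, $\chi\in(0,1)$ with $\sum_s|P_\mu^t(s_0,s)-d_\mu(s)|\le C_M\chi^t$ for all $s_0\in\mathcal S$, $t\ge0$. Let $F_0=1$, $F_t=\gamma\rho(s_{t-1},a_{t-1})F_{t-1}+1$,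 $M_t=\lambda+(1-\lambda)F_t$ along a trajectory $(s_t,a_t)$ of $\mu$. The limits $m(i)=d_\mu(i)\lim_{t\to\infty}\mathbb E[M_t\mid s_t=i]$ exist and depend neither on the trajectory nor on its initial distribution. With $M=\mathrm{diag}(m)$ the matrix $A=\Phi^\top M(I-\gamma\lambda P_\pi)^{-1}(I-\gamma P_\pi)\Phi$ is invertible; put $c=\Phi^\top M(I-\gamma\lambda P_\pi)^{-1}r_\pi$, $\mathcal T^\lambda(\theta)=A\theta-c$, and let $\theta^*_\lambda=A^{-1}c$ be the ETD($\lambda$) fixed point. There are $\mu_\lambda,L_\lambda>0$ with $\langle\mathcal T^\lambda(\theta),\theta-\theta_\lambda^*\rangle\ge\mu_\lambda\|\theta-\theta^*_\lambda\|_2^2$ and $\|\mathcal T^\lambda(\theta)-\mathcal T^\lambda(\theta')\|_2\le L_\lambda\|\theta-\theta'\|_2$ for all $\theta,\theta'$. **Algorithm.** PER-ETD($\lambda$) with period length $b$, stepsizes $\eta_t$ and projection set $\Theta$ runs along one trajectory $(s_n,a_n)_{n\ge0}$ of $\mu$ with an arbitrary initial distribution. Write $s_t^\tau=s_{t(b+1)+\tau}$,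 and $a_t^\tau$, $\rho_t^\tau$, $r_t^\tau$, $\phi_t^\tau$ accordingly. Start with $\theta_0=0$. At iteration $t$ set $F_t^0=M_t^0=1$, $e_t^0=\phi_t^0$; for $\tau=1,\dots,b$ let $F_t^\tau=\gamma\rho_t^{\tau-1}F_t^{\tau-1}+1$, $M_t^\tau=\lambda+(1-\lambda)F_t^\tau$, $e_t^\tau=\gamma\lambda\rho_t^{\tau-1}e_t^{\tau-1}+M_t^\tau\phi_t^\tau$; then let $\theta_{t+1}=\Pi_\Theta\big(\theta_t+\eta_t\rho_t^b(r_t^b+\gamma\theta_t^\top\phi_t^{b+1}-\theta_t^\top\phi_t^b)e_t^b\big)$. **Theorem.** Fix any constants $C_M,\chi,\mu_\lambda,L_\lambda$ as above and let $\xi=\max\{\gamma,\chi\}$ and $$a_\lambda=\frac1{\log_{1/\xi}(\rho_{\max})+1}.$$ Take $\eta_t=\frac{2}{\mu_\lambda(t+t_\lambda)}$ with $t_\lambda=8L_\lambda^2/\mu_\lambda^2$, and $\Theta=\{\theta:\|\theta\|_2\le B_\theta\}$ with $B_\theta=\frac{\|\Phi^\top\|_2\,r_{\max}}{(1-\gamma)\mu_\lambda}$.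 For every $K$ there is a constant $C$, independent of $T$, $\epsilon$, the period lengths and the trajectory (including its initial distribution), such that for all period lengths $b_T\in\mathbb N$ with $$\Big|b_T-\frac{\log T}{\log\rho_{\max}+\log(1/\xi)}\Big|\le K\qquad(T\ge1)$$ (for instance $b_T=\max\{b_0,\lceil\log T/(\log\rho_{\max}+\log(1/\xi))\rceil\}$ with a fixed $b_0$) the following hold. 1. For every $T\ge1$, PER-ETD($\lambda$) run with $b=b_T$ satisfies $\mathbb E\|\theta_T-\theta^*_\lambda\|_2^2\le C\,T^{-a_\lambda}$. 2. For every $\epsilon\in(0,1]$ there is $T\ge1$ such that PER-ETD($\lambda$) run with $b=b_T$ satisfies $\mathbb E\|\theta_T-\theta^*_\lambda\|_2^2\le\epsilon$, and the number of samples used is $T(b_T+1)\le C\,\epsilon^{-1/a_\lambda}(1+\log(1/\epsilon))=\tilde{\mathcal O}(\epsilon^{-1/a_\lambda})$. -/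

import Mathlib

open MeasureTheory ProbabilityTheory Filter Topology Matrix

universe w

namespace PerETD

noncomputable section

/-- A (stationary, randomized) policy: `prob s a` is the probability of action `a` in state `s`. -/
structure Policy (S A : Type*) [Fintype A] where
  prob : S → A → ℝ
  prob_nonneg : ∀ s a, 0 ≤ prob s a
  prob_sum : ∀ s, ∑ a, prob s a = 1

/-- The data of off-policy evaluation with linear function approximation: a finite MDP
(transition kernel, reward, discount factor `γ ∈ (0,1)`), a target policy, a behavior policy,
feature vectors `φ s ∈ ℝᵈ`, and the eligibility parameter `lam ∈ [0,1]`. -/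
structure Problem (S A : Type*) [Fintype S] [Fintype A] (d : ℕ) where
  trans : S → A → S → ℝ
  trans_nonneg : ∀ s a s', 0 ≤ trans s a s'
  trans_sum : ∀ s a, ∑ s', trans s a s' = 1
  reward : S → A → ℝ
  γ : ℝ
  γ_pos : 0 < γ
  γ_lt_one : γ < 1
  target : Policy S A
  behavior : Policy S A
  φ : S → EuclideanSpace ℝ (Fin d)
  lam : ℝ
  lam_nonneg : 0 ≤ lam
  lam_le_one : lam ≤ 1

variable {S A : Type*} [Fintype S] [DecidableEq S] [Fintype A] {d : ℕ}

namespace Problem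

/-- Transition matrix of the state chain under a policy. -/
def chain (p : Problem S A d) (κ : Policy S A) : Matrix S S ℝ :=
  Matrix.of fun s s' => ∑ a, κ.prob s a * p.trans s a s'

/-- Expected one-step reward `r_π` under the target policy. -/
def rewardTarget (p : Problem S A d) : S → ℝ :=
  fun s => ∑ a, p.reward s a * p.target.prob s a

/-- Importance sampling ratio `ρ(s,a) = π(a|s) / μ(a|s)`. -/
def ratio (p : Problem S A d) (s : S) (a : A) : ℝ :=
  p.target.prob s a / p.behavior.prob s a

/-- `ρ_max`, the largest importance sampling ratio. -/
def ratioMax (p : Problem S A d) : ℝ :=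
  ⨆ x : S × A, p.ratio x.1 x.2

/-- `r_max`, the largest absolute reward. -/
def rewardMax (p : Problem S A d) : ℝ :=
  ⨆ x : S × A, |p.reward x.1 x.2|

/-- The feature matrix `Φ`, whose rows are the feature vectors. -/
def featureMatrix (p : Problem S A d) : Matrix S (Fin d) ℝ :=
  Matrix.of fun s j => p.φ s j

/-! ### Assumptions -/

/-- The behavior policy covers the target policy. -/
def Coverage (p : Problem S A d) : Prop :=
  ∀ s a, 0 < p.target.prob s a → 0 < p.behavior.prob s a

/-- The chain with transition matrix `P` is aperiodic: for every state the greatest common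
divisor of the possible return times is one. -/
def Aperiodic (P : Matrix S S ℝ) : Prop :=
  ∀ s, ∀ k : ℕ, (∀ n : ℕ, 0 < n → 0 < (P ^ n) s s → k ∣ n) → k = 1

/-- `ν` is a stationary distribution of the chain with transition matrix `P`. -/
def IsStationary (P : Matrix S S ℝ) (ν : S → ℝ) : Prop :=
  (∀ s, 0 ≤ ν s) ∧ ∑ s, ν s = 1 ∧ ν ᵥ* P = ν

/-- `‖P(s_t = · | s_0) - ν‖₁ ≤ C χᵗ` for all initial states `s_0` and all `t`, where
`C ≥ 0` and `χ ∈ (0,1)`. -/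
def GeometricallyErgodic (P : Matrix S S ℝ) (ν : S → ℝ) (C χ : ℝ) : Prop :=
  0 ≤ C ∧ 0 < χ ∧ χ < 1 ∧ ∀ (s₀ : S) (t : ℕ), ∑ s, |(P ^ t) s₀ s - ν s| ≤ C * χ ^ t

/-- `(s_n, a_n)` is a trajectory generated by the behavior policy, started from an arbitrary
initial distribution: its finite-dimensional distributions are
`P(s_0 = x_0) ∏_{k ≤ n} μ(y_k | x_k) ∏_{k < n} P(x_{k+1} | x_k, y_k)`. -/
structure IsTrajectory (p : Problem S A d) {Ω : Type w} [MeasurableSpace Ω] (Pr : Measure Ω)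
    (s : ℕ → Ω → S) (a : ℕ → Ω → A) : Prop where
  isProbabilityMeasure : IsProbabilityMeasure Pr
  measurable_state : ∀ n x, MeasurableSet {ω | s n ω = x}
  measurable_action : ∀ n y, MeasurableSet {ω | a n ω = y}
  law : ∀ (n : ℕ) (x : ℕ → S) (y : ℕ → A),
    Pr.real {ω | ∀ k ≤ n, s k ω = x k ∧ a k ω = y k} =
      Pr.real {ω | s 0 ω = x 0} * (∏ k ∈ Finset.range (n + 1), p.behavior.prob (x k) (y k)) *
        ∏ k ∈ Finset.range n, p.trans (x k) (y k) (x (k + 1))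

/-! ### Traces along a sample path

`x : ℕ → S` and `y : ℕ → A` are the states and actions of a path. The traces are started at
time `k`; the argument `τ` counts the steps since the start. -/

/-- Follow-on trace: `F⁰ = 1`, `F^{τ+1} = γ ρ^τ F^τ + 1`. -/
def followOn (p : Problem S A d) (x : ℕ → S) (y : ℕ → A) (k : ℕ) : ℕ → ℝ
  | 0 => 1
  | τ + 1 => p.γ * p.ratio (x (k + τ)) (y (k + τ)) * p.followOn x y k τ + 1

/-- Emphasis `M^τ = λ + (1 - λ) F^τ`. -/
def emphasis (p : Problem S A d) (x : ℕ → S) (y : ℕ → A) (k τ : ℕ) : ℝ :=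
  p.lam + (1 - p.lam) * p.followOn x y k τ

/-- Eligibility trace: `e⁰ = φ⁰`, `e^{τ+1} = γ λ ρ^τ e^τ + M^{τ+1} φ^{τ+1}`. -/
def eligibility (p : Problem S A d) (x : ℕ → S) (y : ℕ → A) (k : ℕ) :
    ℕ → EuclideanSpace ℝ (Fin d)
  | 0 => p.φ (x k)
  | τ + 1 => (p.γ * p.lam * p.ratio (x (k + τ)) (y (k + τ))) • p.eligibility x y k τ +
      p.emphasis x y k (τ + 1) • p.φ (x (k + (τ + 1)))

/-! ### The ETD(λ) fixed point -/

/-- `m(i) = d_μ(i) lim_{t → ∞} E[M_t | s_t = i]`, where `M_t` is the emphasis of ETD(λ), whose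
trace is started at time `0` and never restarted. The limit is required along every
trajectory of the behavior policy. -/
def IsEmphasisLimit (p : Problem S A d) (dμ m : S → ℝ) : Prop :=
  ∀ (Ω : Type w) [MeasurableSpace Ω] (Pr : Measure Ω) (s : ℕ → Ω → S) (a : ℕ → Ω → A),
    p.IsTrajectory Pr s a → ∀ i, Tendsto
      (fun t => dμ i * ∫ ω, p.emphasis (fun n => s n ω) (fun n => a n ω) 0 t
        ∂(cond Pr {ω | s t ω = i})) atTop (𝓝 (m i))

/-- `Φᵀ M (I - γλP_π)⁻¹`, where `M = diag m`. -/
def weightMatrix (p : Problem S A d) (m : S → ℝ) : Matrix (Fin d) S ℝ :=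
  p.featureMatrixᵀ * Matrix.diagonal m * (1 - (p.γ * p.lam) • p.chain p.target)⁻¹

/-- The matrix `Φᵀ M (I - γλP_π)⁻¹ (I - γP_π) Φ`. -/
def keyMatrix (p : Problem S A d) (m : S → ℝ) : Matrix (Fin d) (Fin d) ℝ :=
  p.weightMatrix m * (1 - p.γ • p.chain p.target) * p.featureMatrix

/-- The fixed point `θ_λ^*`. -/
def fixedPoint (p : Problem S A d) (m : S → ℝ) : EuclideanSpace ℝ (Fin d) :=
  WithLp.toLp 2 ((p.keyMatrix m)⁻¹ *ᵥ (p.weightMatrix m *ᵥ p.rewardTarget))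

/-- The operator `T^λ(θ) = Φᵀ M (I - γλP_π)⁻¹ (I - γP_π) Φ θ - Φᵀ M (I - γλP_π)⁻¹ r_π`. -/
def operator (p : Problem S A d) (m : S → ℝ) (θ : EuclideanSpace ℝ (Fin d)) :
    EuclideanSpace ℝ (Fin d) :=
  WithLp.toLp 2 (p.keyMatrix m *ᵥ WithLp.ofLp θ - p.weightMatrix m *ᵥ p.rewardTarget)

/-- `κ > 0` is a strong monotonicity constant of `T^λ` at `θ_λ^*`. -/
def IsMonotonicityConst (p : Problem S A d) (m : S → ℝ) (κ : ℝ) : Prop :=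
  0 < κ ∧ ∀ θ, κ * ‖θ - p.fixedPoint m‖ ^ 2 ≤ inner ℝ (p.operator m θ) (θ - p.fixedPoint m)

/-- `L > 0` is a Lipschitz constant of `T^λ`. -/
def IsLipschitzConst (p : Problem S A d) (m : S → ℝ) (L : ℝ) : Prop :=
  0 < L ∧ ∀ θ₁ θ₂, ‖p.operator m θ₁ - p.operator m θ₂‖ ≤ L * ‖θ₁ - θ₂‖

/-! ### The algorithm PER-ETD(λ) -/

/-- Euclidean projection onto the closed ball of radius `B` around the origin. -/
def projBall (B : ℝ) (θ : EuclideanSpace ℝ (Fin d)) : EuclideanSpace ℝ (Fin d) :=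
  if ‖θ‖ ≤ B then θ else (B / ‖θ‖) • θ

/-- `projBall B θ` is the nearest point to `θ` in the closed ball of radius `B`. -/
theorem projBall_spec {B : ℝ} (hB : 0 ≤ B) (θ : EuclideanSpace ℝ (Fin d)) :
    ‖projBall B θ‖ ≤ B ∧ ∀ z : EuclideanSpace ℝ (Fin d), ‖z‖ ≤ B →
      ‖θ - projBall B θ‖ ≤ ‖θ - z‖ := by
  unfold projBall
  split_ifs with h
  · exact ⟨h, fun z _ => by simp⟩
  · have h1 : B < ‖θ‖ := not_le.mp h
    have h0 : 0 < ‖θ‖ := lt_of_le_of_lt hB h1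
    refine ⟨?_, fun z hz => ?_⟩
    · rw [norm_smul, Real.norm_of_nonneg (by positivity), div_mul_cancel₀ _ h0.ne']
    · have h2 : θ - (B / ‖θ‖) • θ = (1 - B / ‖θ‖) • θ := by rw [sub_smul, one_smul]
      have h3 : 0 ≤ 1 - B / ‖θ‖ := by
        rw [sub_nonneg, div_le_one h0]; exact h1.le
      rw [h2, norm_smul, Real.norm_of_nonneg h3, sub_mul, one_mul, div_mul_cancel₀ _ h0.ne']
      have h4 := norm_sub_norm_le θ z
      linarith

/-- The iterates of PER-ETD(λ) with period length `b`, stepsizes `η` and projection onto the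
ball of radius `B`, along the path `x, y`. Iteration `t` uses the transitions
`t(b+1), …, t(b+1)+b`. -/
def iterate (p : Problem S A d) (b : ℕ) (η : ℕ → ℝ) (B : ℝ) (x : ℕ → S) (y : ℕ → A) :
    ℕ → EuclideanSpace ℝ (Fin d)
  | 0 => 0
  | t + 1 =>
    let n := t * (b + 1) + b
    let θ := p.iterate b η B x y t
    projBall B (θ + (η t * (p.ratio (x n) (y n) *
      (p.reward (x n) (y n) + p.γ * inner ℝ θ (p.φ (x (n + 1))) - inner ℝ θ (p.φ (x n))))) •
        p.eligibility x y (t * (b + 1)) b)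

/-- Stepsize `η_t = 2 / (κ (t + t_λ))` with `t_λ = 8 L² / κ²`. -/
def stepsize (κ L : ℝ) (t : ℕ) : ℝ :=
  2 / (κ * (t + 8 * L ^ 2 / κ ^ 2))

open scoped Matrix.Norms.L2Operator in
/-- Radius `B_θ = ‖Φᵀ‖₂ r_max / ((1 - γ) κ)` of the projection set. -/
def radius (p : Problem S A d) (κ : ℝ) : ℝ :=
  ‖p.featureMatrixᵀ‖ * p.rewardMax / ((1 - p.γ) * κ)

/-- The mean square error `E ‖θ_T - θ_λ^*‖²` of PER-ETD(λ) with period length `b` along every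
trajectory of the behavior policy is (defined and) at most `bound`. -/
def MeanSquareErrorLE (p : Problem S A d) (m : S → ℝ) (κ L : ℝ) (b T : ℕ) (bound : ℝ) : Prop :=
  ∀ (Ω : Type w) [MeasurableSpace Ω] (Pr : Measure Ω) (s : ℕ → Ω → S) (a : ℕ → Ω → A),
    p.IsTrajectory Pr s a →
      Integrable (fun ω => ‖p.iterate b (stepsize κ L) (p.radius κ)
        (fun n => s n ω) (fun n => a n ω) T - p.fixedPoint m‖ ^ 2) Pr ∧
      ∫ ω, ‖p.iterate b (stepsize κ L) (p.radius κ)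
        (fun n => s n ω) (fun n => a n ω) T - p.fixedPoint m‖ ^ 2 ∂Pr ≤ bound

end Problem

end

end PerETD

set_option linter.unusedSectionVars false

/-! The error splits into a bias, caused by restarting the traces, that decays geometrically in `b`,
and a variance that grows like `ρ_max ^ b` but is divided by `T` through the stepsizes. The
logarithmic period length balances the two.

Well-posedness. The emphatic weight `m` is chosen so that `mᵀ (I - γλP_π)⁻¹ (I - γP_π) = d_μᵀ`. The
matrix `(I - γλP_π)⁻¹ (I - γP_π)` is `I - Q` with `Q ≥ 0` and row sums at most one. By the
arithmetic-geometric mean inequality, the quadratic form of `diag(m)(I - Q)` is then at least half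
that of `diag(d_μ)` (`half_sum_le_dotProduct_mulVec`). Since `d_μ > 0` and `Φ` is injective, `A` is
positive definite.

Bias. No conditional expectations are used. For a weight `W` known when the period starts, one
follows the vector `i ↦ E[W Z 1{s_n = i}]`, where `Z` is a trace. One step multiplies it by `P_μ`,
or by `P_π` if a factor `ρ` is present, so the trace recursions become affine recursions for
vectors. The maps `γP_π` and `γλP_π` contract in `ℓ¹`, and the forcing converges by mixing of `P_μ`.
Hence the vector approaches `E[W]` times its limit with error of order `ζ ^ τ E|W|`, for any `ζ > γ`
with `ζ ≥ χ` (`exists_l1_occupation_eligibility_le`). Taking for `W` the coordinates of `θ_t - θ*`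
and their products with those of `θ_t` shows that the mean update is the negated operator up to this
error (`exists_mean_update_le`).

Variance. In `E[ρ² Z²]` one factor `ρ` changes the action law to `π` and the other is bounded by
`ρ_max`, so second moments of the traces grow like `ρ_max ^ τ`.

Conclusion. `θ*` lies in the projection ball, so projecting does not increase the distance to it.
With `ζ = √ξ` and Young's inequality the mean square error obeys a recursion whose solution is of
order `ξ ^ b + ρ_max ^ b / T` (`exists_meanSquareErrorLE`). For the prescribed `b` both terms are of
order `T ^ (-a_λ)`, and solving for `T` gives the sample count. -/

namespace PerETD

/-! ### Stationarity and geometric mixing of finite Markov chains -/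

section Chain

variable {S : Type*} [Fintype S]

/-- The `ℓ¹` norm of a vector. -/
noncomputable def l1 (v : S → ℝ) : ℝ := ∑ i, |v i|

theorem l1_nonneg (v : S → ℝ) : 0 ≤ l1 v := Finset.sum_nonneg fun _ _ => abs_nonneg _

theorem l1_add_le (u v : S → ℝ) : l1 (u + v) ≤ l1 u + l1 v := by
  unfold l1
  rw [← Finset.sum_add_distrib]
  exact Finset.sum_le_sum fun i _ => abs_add_le _ _

theorem l1_smul (c : ℝ) (v : S → ℝ) : l1 (c • v) = |c| * l1 v := by
  simp [l1, abs_mul, Finset.mul_sum]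

variable [DecidableEq S]

theorem l1_vecMul_le {P : Matrix S S ℝ} (hP : P ∈ rowStochastic ℝ S) (v : S → ℝ) :
    l1 (v ᵥ* P) ≤ l1 v := by
  calc l1 (v ᵥ* P) ≤ ∑ j, ∑ i, |v i| * P i j := by
        refine Finset.sum_le_sum fun j _ => ?_
        refine (Finset.abs_sum_le_sum_abs _ _).trans (Finset.sum_le_sum fun i _ => ?_)
        rw [abs_mul, abs_of_nonneg (nonneg_of_mem_rowStochastic hP)]
    _ = l1 v := by
        rw [Finset.sum_comm]
        refine Finset.sum_congr rfl fun i _ => ?_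
        rw [← Finset.mul_sum, sum_row_of_mem_rowStochastic hP, mul_one]

theorem sum_vecMul {P : Matrix S S ℝ} (hP : P ∈ rowStochastic ℝ S) (v : S → ℝ) :
    ∑ j, (v ᵥ* P) j = ∑ i, v i := by
  simp only [vecMul, dotProduct]
  rw [Finset.sum_comm]
  refine Finset.sum_congr rfl fun i _ => ?_
  rw [← Finset.mul_sum, sum_row_of_mem_rowStochastic hP, mul_one]

theorem pow_add_pos {P : Matrix S S ℝ} (hP : ∀ i j, 0 ≤ P i j) {a b : ℕ} {i j k : S}
    (h1 : 0 < (P ^ a) i j) (h2 : 0 < (P ^ b) j k) : 0 < (P ^ (a + b)) i k := by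
  rw [pow_add, mul_apply]
  exact Finset.sum_pos' (fun l _ => mul_nonneg (pow_apply_nonneg hP a i l)
    (pow_apply_nonneg hP b l k)) ⟨j, Finset.mem_univ _, mul_pos h1 h2⟩

/-- In an aperiodic chain, all sufficiently large times are possible return times. -/
theorem exists_forall_return_pos {P : Matrix S S ℝ} (hP : ∀ i j, 0 ≤ P i j)
    (haper : Problem.Aperiodic P) (s : S) : ∃ n₀ : ℕ, ∀ n ≥ n₀, 0 < (P ^ n) s s := by
  set R : Set ℕ := {n | 0 < n ∧ 0 < (P ^ n) s s} with hR
  have hg : Nat.setGcd R = 1 :=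
    haper s _ fun n hn hp => Nat.setGcd_dvd_of_mem ⟨hn, hp⟩
  -- The additive monoid generated by a set of naturals contains all large multiples of its gcd,
  -- which is one here; return times are closed under addition.
  obtain ⟨n₀, hn₀⟩ := Nat.exists_mem_closure_of_ge R
  refine ⟨n₀, fun n hn => ?_⟩
  have hmem := hn₀ n hn (by rw [hg]; exact one_dvd _)
  refine AddSubmonoid.closure_induction (fun m hm => hm.2) ?_
    (fun a b _ _ ha hb => pow_add_pos hP ha hb) hmem
  simp

/-- An irreducible aperiodic nonnegative matrix is primitive. -/
theorem exists_pow_pos {P : Matrix S S ℝ} (hirr : P.IsIrreducible)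
    (haper : Problem.Aperiodic P) : ∃ N : ℕ, 0 < N ∧ ∀ i j, 0 < (P ^ N) i j := by
  have hP := hirr.nonneg
  choose n₀ hn₀ using fun s => exists_forall_return_pos hP haper s
  choose k _ hk using (isIrreducible_iff_exists_pow_pos hP).1 hirr
  -- This time exceeds every `k i j` by more than every `n₀ i`: loop at `i` for the surplus, then
  -- travel to `j` in `k i j` steps.
  refine ⟨(∑ s, n₀ s) + (∑ i, ∑ j, k i j) + 1, by omega, fun i j => ?_⟩
  have h1 : n₀ i ≤ ∑ s, n₀ s :=
    Finset.single_le_sum (f := n₀) (fun _ _ => Nat.zero_le _) (Finset.mem_univ i)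
  have h2 : k i j ≤ ∑ i, ∑ j, k i j :=
    (Finset.single_le_sum (f := k i) (fun _ _ => Nat.zero_le _) (Finset.mem_univ j)).trans
      (Finset.single_le_sum (f := fun i => ∑ j, k i j) (fun _ _ => Nat.zero_le _)
        (Finset.mem_univ i))
  have h3 : (∑ s, n₀ s) + (∑ i, ∑ j, k i j) + 1 =
      ((∑ s, n₀ s) + (∑ i, ∑ j, k i j) + 1 - k i j) + k i j := by omega
  rw [h3]
  exact pow_add_pos hP (hn₀ i _ (by omega)) (hk i j)

/-- Doeblin contraction for a stochastic matrix with positive entries. -/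
theorem exists_contraction [Nonempty S] {Q : Matrix S S ℝ} (hQ : Q ∈ rowStochastic ℝ S)
    (hpos : ∀ i j, 0 < Q i j) : ∃ α : ℝ, 0 < α ∧ α < 1 ∧
      ∀ v : S → ℝ, ∑ i, v i = 0 → l1 (v ᵥ* Q) ≤ α * l1 v := by
  obtain ⟨⟨i₀, j₀⟩, -, hmin⟩ := Finset.exists_min_image (Finset.univ : Finset (S × S))
    (fun x => Q x.1 x.2) Finset.univ_nonempty
  -- Half the smallest entry, so that `δ * card S ≤ 1 / 2` and the contraction factor stays strictly
  -- positive.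
  set δ : ℝ := Q i₀ j₀ / 2
  have hδ : 0 < δ := half_pos (hpos _ _)
  have hle : ∀ i j, 2 * δ ≤ Q i j := fun i j => by
    have := hmin (i, j) (Finset.mem_univ _)
    simp only [δ] at *; linarith
  have hcard : (0 : ℝ) < Fintype.card S := by exact_mod_cast Fintype.card_pos
  have h2 : 2 * δ * Fintype.card S ≤ 1 := by
    rw [← sum_row_of_mem_rowStochastic hQ i₀]
    calc 2 * δ * Fintype.card S = ∑ _j : S, 2 * δ := by simp [mul_comm]
      _ ≤ _ := Finset.sum_le_sum fun j _ => hle i₀ j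
  refine ⟨1 - δ * Fintype.card S, by nlinarith, by nlinarith, fun v hv => ?_⟩
  calc l1 (v ᵥ* Q) ≤ ∑ j, ∑ i, |v i| * (Q i j - δ) := by
        refine Finset.sum_le_sum fun j _ => ?_
        -- Because `v` has total mass zero, a constant may be subtracted from every entry of `Q`
        -- without changing the product.
        have : (v ᵥ* Q) j = ∑ i, v i * (Q i j - δ) := by
          simp only [vecMul, dotProduct, mul_sub, Finset.sum_sub_distrib, ← Finset.sum_mul, hv]
          ring
        rw [this]
        refine (Finset.abs_sum_le_sum_abs _ _).trans (Finset.sum_le_sum fun i _ => ?_)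
        rw [abs_mul, abs_of_nonneg (by linarith [hle i j] : 0 ≤ Q i j - δ)]
    _ = (1 - δ * Fintype.card S) * l1 v := by
        rw [Finset.sum_comm, l1, Finset.mul_sum]
        refine Finset.sum_congr rfl fun i _ => ?_
        rw [← Finset.mul_sum, Finset.sum_sub_distrib, sum_row_of_mem_rowStochastic hQ]
        simp
        ring

/-- Some power `P ^ N` contracts zero-mass vectors by a factor `α`; the `N`-th root of `α` is a rate
per step. -/
theorem exists_geometric_contraction [Nonempty S] {P : Matrix S S ℝ}
    (hP : P ∈ rowStochastic ℝ S) (hirr : P.IsIrreducible) (haper : Problem.Aperiodic P) :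
    ∃ C χ : ℝ, 0 ≤ C ∧ 0 < χ ∧ χ < 1 ∧
      ∀ v : S → ℝ, ∑ i, v i = 0 → ∀ t : ℕ, l1 (v ᵥ* P ^ t) ≤ C * χ ^ t * l1 v := by
  obtain ⟨N, hN, hpos⟩ := exists_pow_pos hirr haper
  obtain ⟨α, h0, h1, hα⟩ := exists_contraction (pow_mem hP N) hpos
  have hχN : (α ^ (1 / (N : ℝ))) ^ N = α := by
    rw [← Real.rpow_natCast, ← Real.rpow_mul h0.le, one_div_mul_cancel (by positivity),
      Real.rpow_one]
  have hχ1 : α ^ (1 / (N : ℝ)) < 1 := Real.rpow_lt_one h0.le h1 (by positivity)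
  have hχ0 : 0 < α ^ (1 / (N : ℝ)) := Real.rpow_pos_of_pos h0 _
  set χ := α ^ (1 / (N : ℝ))
  -- The factor `1 / α` covers the times `t < N`, where `χ ^ t ≥ χ ^ N = α`.
  refine ⟨1 / α, χ, by positivity, hχ0, hχ1, fun v hv t => ?_⟩
  induction t using Nat.strong_induction_on with
  | _ t ih =>
    rcases lt_or_ge t N with h | h
    · refine (l1_vecMul_le (pow_mem hP t) v).trans ?_
      refine le_mul_of_one_le_left (l1_nonneg v) ?_
      rw [one_div_mul_eq_div, le_div_iff₀ h0, one_mul]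
      conv_lhs => rw [← hχN]
      exact pow_le_pow_of_le_one hχ0.le hχ1.le h.le
    · obtain ⟨r, rfl⟩ := Nat.exists_eq_add_of_le' h
      rw [pow_add P, ← vecMul_vecMul]
      refine (hα _ (by rw [sum_vecMul (pow_mem hP r), hv])).trans ?_
      refine (mul_le_mul_of_nonneg_left (ih r (by omega)) h0.le).trans (le_of_eq ?_)
      rw [pow_add, hχN]
      ring

/-- Started from a point mass `e`, consecutive laws differ by `(eP - e)P ^ t`, which is
geometrically small since `eP - e` has zero mass. The laws are Cauchy, and their limit is invariant
by continuity. -/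
theorem exists_isStationary [Nonempty S] {P : Matrix S S ℝ}
    (hP : P ∈ rowStochastic ℝ S) (hirr : P.IsIrreducible) (haper : Problem.Aperiodic P) :
    ∃ ν, Problem.IsStationary P ν := by
  obtain ⟨C, χ, hC, hχ0, hχ1, hc⟩ := exists_geometric_contraction hP hirr haper
  obtain ⟨s₀⟩ := ‹Nonempty S›
  set e : S → ℝ := Pi.single s₀ 1
  have hsum : ∑ i, e i = 1 := by simp [e]
  have hcauchy : CauchySeq fun t : ℕ => e ᵥ* P ^ t := by
    refine cauchySeq_of_le_geometric χ (C * l1 (e ᵥ* P - e)) hχ1 fun t => ?_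
    have h1 : e ᵥ* P ^ (t + 1) - e ᵥ* P ^ t = (e ᵥ* P - e) ᵥ* P ^ t := by
      rw [sub_vecMul, vecMul_vecMul, pow_succ']
    have h2 := hc (e ᵥ* P - e) (by simp [Finset.sum_sub_distrib, sum_vecMul hP]) t
    rw [← h1] at h2
    have hl := l1_nonneg (e ᵥ* P - e)
    rw [dist_comm, dist_eq_norm, pi_norm_le_iff_of_nonneg (by positivity)]
    intro i
    calc _ ≤ l1 (e ᵥ* P ^ (t + 1) - e ᵥ* P ^ t) :=
          Finset.single_le_sum (f := fun i => |(e ᵥ* P ^ (t + 1) - e ᵥ* P ^ t) i|)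
            (fun _ _ => abs_nonneg _) (Finset.mem_univ i)
      _ ≤ _ := h2.trans (le_of_eq (by ring))
  obtain ⟨ν, hν⟩ := cauchySeq_tendsto_of_complete hcauchy
  refine ⟨ν, fun s => ?_, ?_, ?_⟩
  · refine ge_of_tendsto' ((tendsto_pi_nhds.1 hν) s) fun t => ?_
    exact Finset.sum_nonneg fun i _ => mul_nonneg (by by_cases h : i = s₀ <;> simp [e, h])
      (nonneg_of_mem_rowStochastic (pow_mem hP t))
  · refine tendsto_nhds_unique (tendsto_finsetSum _ fun i _ => (tendsto_pi_nhds.1 hν) i) ?_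
    simp [sum_vecMul (pow_mem hP _), hsum]
  · refine tendsto_nhds_unique (f := fun t : ℕ => (e ᵥ* P ^ t) ᵥ* P) (l := atTop) ?_ ?_
    · exact ((continuous_id.matrix_vecMul continuous_const).tendsto ν).comp hν
    · simp only [vecMul_vecMul, ← pow_succ]
      exact hν.comp (tendsto_add_atTop_nat 1)

theorem IsStationary.vecMul_pow {P : Matrix S S ℝ} {ν : S → ℝ}
    (h : Problem.IsStationary P ν) (t : ℕ) : ν ᵥ* P ^ t = ν := by
  induction t with
  | zero => simp
  | succ t ih => rw [pow_succ, ← vecMul_vecMul, ih, h.2.2]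

theorem IsStationary.pos [Nonempty S] {P : Matrix S S ℝ} {ν : S → ℝ}
    (h : Problem.IsStationary P ν) (hirr : P.IsIrreducible) (s : S) : 0 < ν s := by
  obtain ⟨i, hi⟩ : ∃ i, 0 < ν i := by
    by_contra! hn
    have := h.2.1
    rw [Finset.sum_eq_zero fun i _ => le_antisymm (hn i) (h.1 i)] at this
    exact zero_ne_one this
  obtain ⟨k, -, hk⟩ := (isIrreducible_iff_exists_pow_pos hirr.nonneg).1 hirr i s
  rw [← IsStationary.vecMul_pow h k]
  exact Finset.sum_pos' (fun j _ => mul_nonneg (h.1 j) (pow_apply_nonneg hirr.nonneg k j s))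
    ⟨i, Finset.mem_univ _, mul_pos hi hk⟩

theorem IsStationary.unique [Nonempty S] {P : Matrix S S ℝ}
    (hP : P ∈ rowStochastic ℝ S) (hirr : P.IsIrreducible) (haper : Problem.Aperiodic P)
    {ν ν' : S → ℝ} (h : Problem.IsStationary P ν) (h' : Problem.IsStationary P ν') :
    ν = ν' := by
  obtain ⟨C, χ, hC, hχ0, hχ1, hc⟩ := exists_geometric_contraction hP hirr haper
  have h1 : ∀ t : ℕ, l1 (ν - ν') ≤ C * χ ^ t * l1 (ν - ν') := fun t => by
    have := hc (ν - ν') (by simp [Finset.sum_sub_distrib, h.2.1, h'.2.1]) t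
    rwa [sub_vecMul, IsStationary.vecMul_pow h, IsStationary.vecMul_pow h'] at this
  have h2 : l1 (ν - ν') ≤ 0 := by
    refine ge_of_tendsto' (x := atTop) (f := fun t : ℕ => C * χ ^ t * l1 (ν - ν')) ?_ h1
    have := ((tendsto_pow_atTop_nhds_zero_of_lt_one hχ0.le hχ1).const_mul C).mul_const
      (l1 (ν - ν'))
    simpa using this
  have h3 := (Finset.sum_eq_zero_iff_of_nonneg fun i _ => abs_nonneg ((ν - ν') i)).1
    (le_antisymm h2 (l1_nonneg _))
  funext i
  have := h3 i (Finset.mem_univ i)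
  simpa [sub_eq_zero] using this

theorem exists_geometricallyErgodic [Nonempty S] {P : Matrix S S ℝ}
    (hP : P ∈ rowStochastic ℝ S) (hirr : P.IsIrreducible) (haper : Problem.Aperiodic P)
    {ν : S → ℝ} (h : Problem.IsStationary P ν) :
    ∃ C χ : ℝ, Problem.GeometricallyErgodic P ν C χ := by
  obtain ⟨C, χ, hC, hχ0, hχ1, hc⟩ := exists_geometric_contraction hP hirr haper
  refine ⟨C * 2, χ, by positivity, hχ0, hχ1, fun s₀ t => ?_⟩
  have h1 := hc (Pi.single s₀ 1 - ν) (by simp [Finset.sum_sub_distrib, h.2.1]) t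
  rw [sub_vecMul, IsStationary.vecMul_pow h, single_one_vecMul] at h1
  have h2 : l1 (Pi.single s₀ 1 - ν) ≤ 2 := by
    rw [sub_eq_add_neg, show (2 : ℝ) = 1 + 1 by norm_num]
    refine (l1_add_le _ _).trans (add_le_add ?_ ?_)
    · simp [l1, Pi.single_apply, apply_ite abs]
    · simp only [l1, Pi.neg_apply, abs_neg]
      rw [Finset.sum_congr rfl fun i _ => abs_of_nonneg (h.1 i), h.2.1]
  calc _ = l1 ((P ^ t).row s₀ - ν) := by simp [l1]
    _ ≤ _ := h1
    _ ≤ C * χ ^ t * 2 := mul_le_mul_of_nonneg_left h2 (by positivity)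
    _ = _ := by ring

/-- Any signed initial measure mixes at the geometric rate. -/
theorem l1_vecMul_pow_sub_le {P : Matrix S S ℝ} {ν : S → ℝ} {C χ : ℝ}
    (h : Problem.GeometricallyErgodic P ν C χ) (q : S → ℝ) (t : ℕ) :
    l1 (q ᵥ* P ^ t - (∑ i, q i) • ν) ≤ l1 q * (C * χ ^ t) := by
  calc l1 (q ᵥ* P ^ t - (∑ i, q i) • ν) ≤ ∑ j, ∑ i, |q i| * |(P ^ t) i j - ν j| := by
        refine Finset.sum_le_sum fun j _ => ?_
        have : (q ᵥ* P ^ t - (∑ i, q i) • ν) j = ∑ i, q i * ((P ^ t) i j - ν j) := by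
          simp only [vecMul, dotProduct, mul_sub, Finset.sum_sub_distrib, ← Finset.sum_mul,
            Pi.sub_apply, Pi.smul_apply, smul_eq_mul]
        rw [this]
        refine (Finset.abs_sum_le_sum_abs _ _).trans (Finset.sum_le_sum fun i _ => ?_)
        rw [abs_mul]
    _ = ∑ i, |q i| * ∑ j, |(P ^ t) i j - ν j| := by
        rw [Finset.sum_comm]
        simp [Finset.mul_sum]
    _ ≤ ∑ i, |q i| * (C * χ ^ t) :=
        Finset.sum_le_sum fun i _ => mul_le_mul_of_nonneg_left (h.2.2.2 i t) (abs_nonneg _)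
    _ = _ := by rw [← Finset.sum_mul, l1]

end Chain

end PerETD

/-! ### Resolvents of stochastic matrices and positive definiteness -/

namespace PerETD

section Resolvent

variable {S : Type*} [Fintype S] [DecidableEq S]

/-- Minimum principle for `1 - c P` with `P` stochastic and `0 ≤ c < 1`. -/
theorem nonneg_of_one_sub_mulVec_nonneg {P : Matrix S S ℝ} (hP : P ∈ rowStochastic ℝ S)
    {c : ℝ} (h0 : 0 ≤ c) (h1 : c < 1) {v : S → ℝ}
    (h : ∀ i, 0 ≤ ((1 - c • P) *ᵥ v) i) (i : S) : 0 ≤ v i := by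
  obtain ⟨k, -, hk⟩ := Finset.exists_min_image Finset.univ v ⟨i, Finset.mem_univ i⟩
  have h2 : v k ≤ (P *ᵥ v) k := by
    calc v k = ∑ j, P k j * v k := by
          rw [← Finset.sum_mul, sum_row_of_mem_rowStochastic hP, one_mul]
      _ ≤ _ := Finset.sum_le_sum fun j hj =>
          mul_le_mul_of_nonneg_left (hk j hj) (nonneg_of_mem_rowStochastic hP)
  have h3 := h k
  simp only [sub_mulVec, one_mulVec, smul_mulVec, Pi.sub_apply, Pi.smul_apply, smul_eq_mul] at h3
  have h4 : c * v k ≤ c * (P *ᵥ v) k := mul_le_mul_of_nonneg_left h2 h0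
  have h5 : 0 ≤ (1 - c) * v k := by
    linarith
  exact (nonneg_of_mul_nonneg_right h5 (by linarith)).trans (hk i (Finset.mem_univ i))

/-- The minimum principle applied to both differences of two vectors with the same image gives
injectivity. -/
theorem isUnit_one_sub_smul {P : Matrix S S ℝ} (hP : P ∈ rowStochastic ℝ S)
    {c : ℝ} (h0 : 0 ≤ c) (h1 : c < 1) : IsUnit (1 - c • P).det := by
  rw [← isUnit_iff_isUnit_det, ← mulVec_injective_iff_isUnit]
  intro v w hvw
  have key : ∀ a b : S → ℝ, (1 - c • P) *ᵥ a = (1 - c • P) *ᵥ b → ∀ i, b i ≤ a i := by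
    intro a b hab i
    have := nonneg_of_one_sub_mulVec_nonneg hP h0 h1 (v := a - b)
      (fun i => by rw [mulVec_sub, hab, sub_self]; rfl) i
    simpa using this
  exact funext fun i => le_antisymm (key _ _ hvw.symm i) (key _ _ hvw i)

theorem resolvent_nonneg {P : Matrix S S ℝ} (hP : P ∈ rowStochastic ℝ S)
    {c : ℝ} (h0 : 0 ≤ c) (h1 : c < 1) (i j : S) : 0 ≤ (1 - c • P)⁻¹ i j := by
  have h := nonneg_of_one_sub_mulVec_nonneg hP h0 h1 (v := (1 - c • P)⁻¹ *ᵥ Pi.single j 1)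
    (fun i => by
      rw [mulVec_mulVec, mul_nonsing_inv _ (isUnit_one_sub_smul hP h0 h1), one_mulVec]
      by_cases h : i = j
      · subst h; simp
      · simp [h]) i
  simpa using h

theorem resolvent_mulVec_one {P : Matrix S S ℝ} (hP : P ∈ rowStochastic ℝ S)
    {c : ℝ} (h0 : 0 ≤ c) (h1 : c < 1) (i : S) : ∑ j, (1 - c • P)⁻¹ i j = 1 / (1 - c) := by
  have h2 : (1 - c • P) *ᵥ (1 : S → ℝ) = (1 - c) • (1 : S → ℝ) := by
    rw [sub_mulVec, one_mulVec, smul_mulVec, one_vecMul_of_mem_rowStochastic hP, sub_smul, one_smul]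
  have h3 : (1 : S → ℝ) = (1 - c) • ((1 - c • P)⁻¹ *ᵥ (1 : S → ℝ)) := by
    rw [← mulVec_smul, ← h2, mulVec_mulVec, nonsing_inv_mul _ (isUnit_one_sub_smul hP h0 h1),
      one_mulVec]
  have h4 := congrFun h3 i
  have h5 : ((1 - c • P)⁻¹ *ᵥ (1 : S → ℝ)) i = ∑ j, (1 - c • P)⁻¹ i j := by
    simp [mulVec, dotProduct]
  rw [Pi.smul_apply, h5, smul_eq_mul, Pi.one_apply] at h4
  rw [eq_div_iff (by linarith), mul_comm, ← h4]

/-- Emphatic weightings make `diag(m) (1 - Q)` positive definite. -/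
theorem half_sum_le_dotProduct_mulVec {Q : Matrix S S ℝ} {m δ : S → ℝ}
    (hQ : ∀ i j, 0 ≤ Q i j) (hQ1 : ∀ i, ∑ j, Q i j ≤ 1) (hm : ∀ i, 0 ≤ m i)
    (hδ : m ᵥ* (1 - Q) = δ) (v : S → ℝ) :
    1 / 2 * ∑ i, δ i * v i ^ 2 ≤ v ⬝ᵥ ((diagonal m * (1 - Q)) *ᵥ v) := by
  have e1 : v ⬝ᵥ ((diagonal m * (1 - Q)) *ᵥ v) =
      ∑ i, m i * v i ^ 2 - ∑ i, ∑ j, m i * Q i j * (v i * v j) := by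
    rw [← mulVec_mulVec, ← Finset.sum_sub_distrib]
    refine Finset.sum_congr rfl fun i _ => ?_
    rw [mulVec_diagonal, sub_mulVec, one_mulVec, Pi.sub_apply]
    simp only [mulVec, dotProduct, mul_sub, Finset.mul_sum]
    congr 1
    · ring
    · exact Finset.sum_congr rfl fun j _ => by ring
  have e2 : ∑ i, δ i * v i ^ 2 = ∑ i, m i * v i ^ 2 - ∑ i, ∑ j, m i * Q i j * v j ^ 2 := by
    rw [Finset.sum_comm, ← Finset.sum_sub_distrib]
    refine Finset.sum_congr rfl fun j _ => ?_
    rw [← hδ, vecMul_sub, vecMul_one, Pi.sub_apply, sub_mul]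
    simp only [vecMul, dotProduct, Finset.sum_mul]
  have e3 : ∑ i, ∑ j, m i * Q i j * v i ^ 2 ≤ ∑ i, m i * v i ^ 2 := by
    refine Finset.sum_le_sum fun i _ => ?_
    rw [← Finset.sum_mul, ← Finset.mul_sum]
    have := mul_le_mul_of_nonneg_left (hQ1 i) (hm i)
    nlinarith [sq_nonneg (v i)]
  -- Termwise `2 v_i v_j ≤ v_i² + v_j²`. The first square is absorbed by the row sums of `Q` (`e3`),
  -- the second by the column identity defining `δ` (`e2`).
  have e4 : ∑ i, ∑ j, m i * Q i j * (v i * v j) ≤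
      1 / 2 * ∑ i, ∑ j, m i * Q i j * v i ^ 2 + 1 / 2 * ∑ i, ∑ j, m i * Q i j * v j ^ 2 := by
    simp only [Finset.mul_sum, ← Finset.sum_add_distrib]
    refine Finset.sum_le_sum fun i _ => Finset.sum_le_sum fun j _ => ?_
    have := mul_nonneg (mul_nonneg (hm i) (hQ i j)) (sq_nonneg (v i - v j))
    nlinarith
  rw [e1, e2]
  linarith

end Resolvent

variable {S A : Type*} [Fintype S] [DecidableEq S] [Fintype A] {d : ℕ}

/-! ### Emphatic weights, the key matrix and the fixed point -/

namespace Problem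

theorem chain_mem_rowStochastic (p : Problem S A d) (κ : Policy S A) :
    p.chain κ ∈ rowStochastic ℝ S := by
  rw [mem_rowStochastic_iff_sum]
  refine ⟨fun i j => Finset.sum_nonneg fun a _ =>
    mul_nonneg (κ.prob_nonneg _ _) (p.trans_nonneg _ _ _), fun i => ?_⟩
  simp only [chain, of_apply]
  rw [Finset.sum_comm]
  simp only [← Finset.mul_sum, p.trans_sum, mul_one, κ.prob_sum]

theorem γlam_nonneg (p : Problem S A d) : 0 ≤ p.γ * p.lam :=
  mul_nonneg p.γ_pos.le p.lam_nonneg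

theorem γlam_le (p : Problem S A d) : p.γ * p.lam ≤ p.γ :=
  mul_le_of_le_one_right p.γ_pos.le p.lam_le_one

theorem γlam_lt_one (p : Problem S A d) : p.γ * p.lam < 1 := p.γlam_le.trans_lt p.γ_lt_one

/-- The limit of `d_μ(i) E[F_t | s_t = i]`. -/
noncomputable def followOnLimit (p : Problem S A d) (dμ : S → ℝ) : S → ℝ :=
  dμ ᵥ* (1 - p.γ • p.chain p.target)⁻¹

/-- The limit of `d_μ(i) E[M_t | s_t = i]`. -/
noncomputable def emphasisLimit (p : Problem S A d) (dμ : S → ℝ) : S → ℝ :=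
  p.lam • dμ + (1 - p.lam) • p.followOnLimit dμ

section Limit

variable (p : Problem S A d) (dμ : S → ℝ)

theorem isUnit_det_target {c : ℝ} (h0 : 0 ≤ c) (h1 : c < 1) :
    IsUnit (1 - c • p.chain p.target).det :=
  isUnit_one_sub_smul (p.chain_mem_rowStochastic _) h0 h1

theorem followOnLimit_eq :
    p.followOnLimit dμ = dμ + p.γ • (p.followOnLimit dμ ᵥ* p.chain p.target) := by
  have h : p.followOnLimit dμ ᵥ* (1 - p.γ • p.chain p.target) = dμ := by
    rw [followOnLimit, vecMul_vecMul,
      nonsing_inv_mul _ (p.isUnit_det_target p.γ_pos.le p.γ_lt_one), vecMul_one]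
  rw [vecMul_sub, vecMul_one, vecMul_smul, sub_eq_iff_eq_add] at h
  exact h

theorem sum_followOnLimit : ∑ i, p.followOnLimit dμ i = (∑ i, dμ i) / (1 - p.γ) := by
  simp only [followOnLimit, vecMul, dotProduct]
  rw [Finset.sum_comm, Finset.sum_div]
  refine Finset.sum_congr rfl fun i _ => ?_
  rw [← Finset.mul_sum, resolvent_mulVec_one (p.chain_mem_rowStochastic _) p.γ_pos.le p.γ_lt_one,
    mul_one_div]

theorem sum_emphasisLimit (h : ∑ i, dμ i = 1) :
    ∑ i, p.emphasisLimit dμ i = (1 - p.γ * p.lam) / (1 - p.γ) := by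
  simp only [emphasisLimit, Pi.add_apply, Pi.smul_apply, smul_eq_mul, Finset.sum_add_distrib,
    ← Finset.mul_sum, sum_followOnLimit, h]
  have : (1 - p.γ) ≠ 0 := by linarith [p.γ_lt_one]
  field_simp
  ring

theorem emphasisLimit_nonneg (h : ∀ i, 0 ≤ dμ i) (i : S) : 0 ≤ p.emphasisLimit dμ i := by
  refine add_nonneg (mul_nonneg p.lam_nonneg (h i)) (mul_nonneg (by linarith [p.lam_le_one]) ?_)
  exact Finset.sum_nonneg fun j _ => mul_nonneg (h j)
    (resolvent_nonneg (p.chain_mem_rowStochastic _) p.γ_pos.le p.γ_lt_one j i)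

/-- With `f = d_μ (I - γP_π)⁻¹`, the follow-on equation turns `λ d_μ + (1 - λ) f` into `f (I -
γλP_π)`. The resolvents then cancel, leaving the strictly positive vector `d_μ` that drives positive
definiteness. -/
theorem emphasisLimit_vecMul :
    p.emphasisLimit dμ ᵥ* ((1 - (p.γ * p.lam) • p.chain p.target)⁻¹ *
      (1 - p.γ • p.chain p.target)) = dμ := by
  have hu := p.isUnit_det_target p.γ_pos.le p.γ_lt_one
  have hv := p.isUnit_det_target p.γlam_nonneg p.γlam_lt_one
  have h : p.emphasisLimit dμ = p.followOnLimit dμ ᵥ* (1 - (p.γ * p.lam) • p.chain p.target) := by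
    have h1 := p.followOnLimit_eq dμ
    have h2 : p.emphasisLimit dμ = p.followOnLimit dμ -
        p.lam • (p.followOnLimit dμ - dμ) := by
      rw [emphasisLimit]; module
    have h3 : p.followOnLimit dμ - dμ = p.γ • (p.followOnLimit dμ ᵥ* p.chain p.target) := by
      rw [sub_eq_iff_eq_add, add_comm]; exact h1
    rw [h2, h3, vecMul_sub, vecMul_one, vecMul_smul, smul_smul, mul_comm p.lam]
  rw [h, vecMul_vecMul, ← mul_assoc, mul_nonsing_inv _ hv, one_mul, followOnLimit, vecMul_vecMul,
    nonsing_inv_mul _ hu, vecMul_one]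

/-- Exhibits the Bellman factor as `1 - Q` with `Q` nonnegative, the form required by
`half_sum_le_dotProduct_mulVec`. -/
theorem resolvent_mul_eq :
    (1 - (p.γ * p.lam) • p.chain p.target)⁻¹ * (1 - p.γ • p.chain p.target) =
      1 - (p.γ * (1 - p.lam)) • ((1 - (p.γ * p.lam) • p.chain p.target)⁻¹ * p.chain p.target) := by
  have hv := p.isUnit_det_target p.γlam_nonneg p.γlam_lt_one
  have h : 1 - p.γ • p.chain p.target = (1 - (p.γ * p.lam) • p.chain p.target) -
      (p.γ * (1 - p.lam)) • p.chain p.target := by module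
  rw [h, mul_sub, nonsing_inv_mul _ hv, mul_smul_comm]

/-- The stationary form of the eligibility recursion: the rows of the weight matrix are the limits
of the eligibility-weighted occupation vectors. -/
theorem weightMatrix_apply_eq (m : S → ℝ) (l : Fin d) (j : S) :
    p.weightMatrix m l j = m j * p.φ j l +
      p.γ * p.lam * ((fun i => p.weightMatrix m l i) ᵥ* p.chain p.target) j := by
  have hv := p.isUnit_det_target p.γlam_nonneg p.γlam_lt_one
  have h : p.weightMatrix m * (1 - (p.γ * p.lam) • p.chain p.target) =
      p.featureMatrixᵀ * diagonal m := by
    rw [weightMatrix, Matrix.mul_assoc, nonsing_inv_mul _ hv, Matrix.mul_one]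
  rw [Matrix.mul_sub, Matrix.mul_one, Matrix.mul_smul, sub_eq_iff_eq_add] at h
  have h1 := congrFun (congrFun h l) j
  rw [h1]
  simp only [Matrix.add_apply, Matrix.smul_apply, mul_diagonal, transpose_apply, featureMatrix,
    of_apply, smul_eq_mul]
  rw [mul_comm (m j)]
  rfl

theorem half_sum_le_keyMatrix (h : ∀ i, 0 ≤ dμ i) (θ : Fin d → ℝ) :
    1 / 2 * ∑ i, dμ i * (p.featureMatrix *ᵥ θ) i ^ 2 ≤
      θ ⬝ᵥ (p.keyMatrix (p.emphasisLimit dμ) *ᵥ θ) := by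
  have hN := resolvent_nonneg (p.chain_mem_rowStochastic p.target) p.γlam_nonneg p.γlam_lt_one
  have hP := p.chain_mem_rowStochastic p.target
  have hc : 0 ≤ p.γ * (1 - p.lam) := mul_nonneg p.γ_pos.le (by linarith [p.lam_le_one])
  have e := half_sum_le_dotProduct_mulVec
    (Q := (p.γ * (1 - p.lam)) • ((1 - (p.γ * p.lam) • p.chain p.target)⁻¹ * p.chain p.target))
    (m := p.emphasisLimit dμ) (δ := dμ)
    (fun i j => mul_nonneg hc (Finset.sum_nonneg fun k _ =>
      mul_nonneg (hN i k) (nonneg_of_mem_rowStochastic hP)))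
    (fun i => by
      have h1 : ∑ j, ((1 - (p.γ * p.lam) • p.chain p.target)⁻¹ * p.chain p.target) i j =
          1 / (1 - p.γ * p.lam) := by
        rw [← resolvent_mulVec_one hP p.γlam_nonneg p.γlam_lt_one i]
        exact sum_vecMul hP _
      simp only [Matrix.smul_apply, smul_eq_mul, ← Finset.mul_sum, h1]
      rw [mul_one_div, div_le_one (by linarith [p.γlam_lt_one])]
      linarith [p.γ_lt_one])
    (p.emphasisLimit_nonneg dμ h)
    (by rw [← resolvent_mul_eq, emphasisLimit_vecMul]) (p.featureMatrix *ᵥ θ)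
  refine e.trans (le_of_eq ?_)
  rw [← resolvent_mul_eq, keyMatrix, weightMatrix]
  simp only [← mulVec_mulVec]
  rw [dotProduct_mulVec θ, vecMul_transpose]

/-- Quantitative positive definiteness of the key matrix. -/
theorem exists_keyMatrix_lower (hφ : LinearIndependent ℝ (fun j : Fin d => fun s : S => p.φ s j))
    (h : ∀ i, 0 < dμ i) :
    ∃ κ : ℝ, 0 < κ ∧ ∀ θ : EuclideanSpace ℝ (Fin d), κ * ‖θ‖ ^ 2 ≤
      WithLp.ofLp θ ⬝ᵥ (p.keyMatrix (p.emphasisLimit dμ) *ᵥ WithLp.ofLp θ) := by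
  have hcol : p.featureMatrix.col = (fun j : Fin d => fun s : S => p.φ s j) := rfl
  have hinj : Function.Injective p.featureMatrix.mulVec := by
    rw [mulVec_injective_iff, hcol]; exact hφ
  set T : EuclideanSpace ℝ (Fin d) →ₗ[ℝ] (S → ℝ) :=
    p.featureMatrix.mulVecLin ∘ₗ (WithLp.linearEquiv 2 ℝ (Fin d → ℝ)).toLinearMap
  have hT : ∀ θ, T θ = p.featureMatrix *ᵥ WithLp.ofLp θ := fun θ => rfl
  have hker : LinearMap.ker T = ⊥ := by
    rw [LinearMap.ker_eq_bot]
    intro a b hab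
    exact (WithLp.ofLp_injective 2) (hinj hab)
  -- An injective linear map on a finite-dimensional space is bounded below; with `δ` the least
  -- value of `d_μ` this yields the constant `δ / (2K²)`.
  obtain ⟨K, hK0, hK⟩ := T.exists_antilipschitzWith hker
  have hb : ∀ θ, ‖θ‖ ≤ K * ‖T θ‖ := fun θ => by
    have := hK.le_mul_dist θ 0
    simpa using this
  obtain ⟨δ, hδ, hδle⟩ : ∃ δ : ℝ, 0 < δ ∧ ∀ i, δ ≤ dμ i := by
    cases isEmpty_or_nonempty S with
    | inl hS => exact ⟨1, one_pos, fun i => (hS.false i).elim⟩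
    | inr hS =>
      obtain ⟨i, hi⟩ := Finite.exists_min dμ
      exact ⟨dμ i, h i, hi⟩
  have hK' : (0 : ℝ) < K := by exact_mod_cast hK0
  refine ⟨δ / (2 * K ^ 2), by positivity, fun θ => ?_⟩
  refine le_trans ?_ (p.half_sum_le_keyMatrix dμ (fun i => (h i).le) _)
  rw [← hT]
  have h1 : ‖T θ‖ ^ 2 ≤ ∑ i, T θ i ^ 2 := by
    have h0 : 0 ≤ ∑ i, T θ i ^ 2 := Finset.sum_nonneg fun i _ => sq_nonneg _
    have : ‖T θ‖ ≤ √(∑ i, T θ i ^ 2) := by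
      rw [pi_norm_le_iff_of_nonneg (Real.sqrt_nonneg _)]
      intro i
      rw [Real.norm_eq_abs, ← Real.sqrt_sq_eq_abs]
      exact Real.sqrt_le_sqrt (Finset.single_le_sum (f := fun i => T θ i ^ 2)
        (fun _ _ => sq_nonneg _) (Finset.mem_univ i))
    calc ‖T θ‖ ^ 2 ≤ √(∑ i, T θ i ^ 2) ^ 2 := pow_le_pow_left₀ (norm_nonneg _) this 2
      _ = _ := Real.sq_sqrt h0
  have h2 : ‖θ‖ ^ 2 ≤ K ^ 2 * ∑ i, T θ i ^ 2 := by
    calc ‖θ‖ ^ 2 ≤ (K * ‖T θ‖) ^ 2 := pow_le_pow_left₀ (norm_nonneg _) (hb θ) 2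
      _ = K ^ 2 * ‖T θ‖ ^ 2 := by ring
      _ ≤ _ := mul_le_mul_of_nonneg_left h1 (by positivity)
  have h3 : δ * ∑ i, T θ i ^ 2 ≤ ∑ i, dμ i * T θ i ^ 2 := by
    rw [Finset.mul_sum]
    exact Finset.sum_le_sum fun i _ => mul_le_mul_of_nonneg_right (hδle i) (sq_nonneg _)
  calc δ / (2 * K ^ 2) * ‖θ‖ ^ 2 ≤ δ / (2 * K ^ 2) * (K ^ 2 * ∑ i, T θ i ^ 2) :=
        mul_le_mul_of_nonneg_left h2 (by positivity)
    _ = 1 / 2 * (δ * ∑ i, T θ i ^ 2) := by field_simp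
    _ ≤ _ := by linarith

theorem isUnit_keyMatrix (hφ : LinearIndependent ℝ (fun j : Fin d => fun s : S => p.φ s j))
    (h : ∀ i, 0 < dμ i) : IsUnit (p.keyMatrix (p.emphasisLimit dμ)).det := by
  obtain ⟨κ, hκ, hle⟩ := p.exists_keyMatrix_lower dμ hφ h
  rw [← isUnit_iff_isUnit_det, ← mulVec_injective_iff_isUnit]
  intro v w hvw
  have h1 := hle (WithLp.toLp 2 (v - w))
  rw [WithLp.ofLp_toLp, mulVec_sub] at h1
  replace hvw : p.keyMatrix (p.emphasisLimit dμ) *ᵥ v = p.keyMatrix (p.emphasisLimit dμ) *ᵥ w := hvw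
  rw [hvw, sub_self, dotProduct_zero] at h1
  have h2 : ‖WithLp.toLp 2 (v - w)‖ = 0 := by
    by_contra hne
    have : 0 < ‖WithLp.toLp 2 (v - w)‖ := lt_of_le_of_ne (norm_nonneg _) (Ne.symm hne)
    nlinarith [mul_pos hκ (pow_pos this 2)]
  rw [norm_eq_zero, WithLp.toLp_eq_zero] at h2
  exact sub_eq_zero.1 h2

variable {p}

theorem operator_sub (m : S → ℝ) (θ₁ θ₂ : EuclideanSpace ℝ (Fin d)) :
    p.operator m θ₁ - p.operator m θ₂ =
      WithLp.toLp 2 (p.keyMatrix m *ᵥ WithLp.ofLp (θ₁ - θ₂)) := by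
  rw [operator, operator, ← WithLp.toLp_sub, WithLp.ofLp_sub, mulVec_sub]
  congr 1
  abel

theorem operator_fixedPoint {m : S → ℝ} (h : IsUnit (p.keyMatrix m).det) :
    p.operator m (p.fixedPoint m) = 0 := by
  rw [operator, fixedPoint, WithLp.ofLp_toLp, mulVec_mulVec, mul_nonsing_inv _ h, one_mulVec,
    sub_self, WithLp.toLp_zero]

/-- The operator vanishes at the fixed point, so it equals the key matrix applied to `θ - θ*` and
positive definiteness is strong monotonicity. -/
theorem exists_isMonotonicityConst
    (hφ : LinearIndependent ℝ (fun j : Fin d => fun s : S => p.φ s j))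
    (h : ∀ i, 0 < dμ i) : ∃ κ, p.IsMonotonicityConst (p.emphasisLimit dμ) κ := by
  obtain ⟨κ, hκ, hle⟩ := p.exists_keyMatrix_lower dμ hφ h
  refine ⟨κ, hκ, fun θ => (hle _).trans (le_of_eq ?_)⟩
  have h1 := operator_sub (p := p) (p.emphasisLimit dμ) θ (p.fixedPoint (p.emphasisLimit dμ))
  rw [operator_fixedPoint (p.isUnit_keyMatrix dμ hφ h), sub_zero] at h1
  rw [h1, EuclideanSpace.inner_eq_star_dotProduct]
  simp

theorem exists_isLipschitzConst (m : S → ℝ) : ∃ L, p.IsLipschitzConst m L := by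
  set T := LinearMap.toContinuousLinearMap (Matrix.toEuclideanLin (p.keyMatrix m))
  refine ⟨‖T‖ + 1, by positivity, fun θ₁ θ₂ => ?_⟩
  rw [operator_sub]
  calc _ = ‖T (θ₁ - θ₂)‖ := rfl
    _ ≤ ‖T‖ * ‖θ₁ - θ₂‖ := T.le_opNorm _
    _ ≤ _ := by nlinarith [norm_nonneg (θ₁ - θ₂)]

/-- A Lipschitz constant dominates a monotonicity constant. -/
theorem monotonicityConst_le_lipschitzConst [NeZero d] {m : S → ℝ} {κ L : ℝ}
    (hu : IsUnit (p.keyMatrix m).det)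
    (hκ : p.IsMonotonicityConst m κ) (hL : p.IsLipschitzConst m L) : κ ≤ L := by
  set v : EuclideanSpace ℝ (Fin d) := EuclideanSpace.single 0 1
  have hv : ‖v‖ = 1 := by simp [v]
  have h1 := hκ.2 (p.fixedPoint m + v)
  have h2 := hL.2 (p.fixedPoint m + v) (p.fixedPoint m)
  rw [operator_fixedPoint hu, sub_zero, add_sub_cancel_left, hv] at h2
  rw [add_sub_cancel_left, hv] at h1
  have h3 := real_inner_le_norm (p.operator m (p.fixedPoint m + v)) v
  rw [hv] at h3
  linarith

theorem abs_reward_le_rewardMax (s : S) (a : A) : |p.reward s a| ≤ p.rewardMax :=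
  le_ciSup (f := fun x : S × A => |p.reward x.1 x.2|) (Set.finite_range _).bddAbove (s, a)

theorem rewardMax_nonneg : 0 ≤ p.rewardMax :=
  Real.iSup_nonneg fun _ => abs_nonneg _

theorem abs_rewardTarget_le (i : S) : |p.rewardTarget i| ≤ p.rewardMax := by
  calc |p.rewardTarget i| ≤ ∑ a, p.rewardMax * p.target.prob i a := by
        refine (Finset.abs_sum_le_sum_abs _ _).trans (Finset.sum_le_sum fun a _ => ?_)
        rw [abs_mul, abs_of_nonneg (p.target.prob_nonneg i a)]
        exact mul_le_mul_of_nonneg_right (abs_reward_le_rewardMax i a) (p.target.prob_nonneg i a)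
    _ = _ := by rw [← Finset.mul_sum, p.target.prob_sum, mul_one]

-- The total mass `(1 - γλ)/(1 - γ)` of `m` cancels the bound `1/(1 - γλ)` on the resolvent, so the
-- constant does not involve `λ`. The `ℓ²` norm is bounded by the `ℓ¹` norm.
open scoped Matrix.Norms.L2Operator in
theorem norm_weightMatrix_mulVec_le (h0 : ∀ i, 0 ≤ dμ i) (h1 : ∑ i, dμ i = 1) :
    ‖WithLp.toLp 2 (p.weightMatrix (p.emphasisLimit dμ) *ᵥ p.rewardTarget)‖ ≤
      ‖p.featureMatrixᵀ‖ * p.rewardMax / (1 - p.γ) := by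
  set m := p.emphasisLimit dμ
  have hm : ∀ i, 0 ≤ m i := p.emphasisLimit_nonneg dμ h0
  have hP := p.chain_mem_rowStochastic p.target
  have hγl := p.γlam_lt_one
  set u : S → ℝ := (1 - (p.γ * p.lam) • p.chain p.target)⁻¹ *ᵥ p.rewardTarget
  have hu : ∀ i, |u i| ≤ p.rewardMax / (1 - p.γ * p.lam) := fun i => by
    calc |u i| ≤ ∑ j, (1 - (p.γ * p.lam) • p.chain p.target)⁻¹ i j * p.rewardMax := by
          refine (Finset.abs_sum_le_sum_abs _ _).trans (Finset.sum_le_sum fun j _ => ?_)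
          have := resolvent_nonneg hP p.γlam_nonneg hγl i j
          rw [abs_mul, abs_of_nonneg this]
          exact mul_le_mul_of_nonneg_left (abs_rewardTarget_le j) this
      _ = _ := by
          rw [← Finset.sum_mul, resolvent_mulVec_one hP p.γlam_nonneg hγl, one_div_mul_eq_div]
  have e : p.weightMatrix m *ᵥ p.rewardTarget = p.featureMatrixᵀ *ᵥ (diagonal m *ᵥ u) := by
    rw [weightMatrix, mulVec_mulVec, mulVec_mulVec]
  have h2 : ‖WithLp.toLp 2 (diagonal m *ᵥ u)‖ ≤ p.rewardMax / (1 - p.γ) := by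
    have hsum : ∑ i, |(diagonal m *ᵥ u) i| ≤ p.rewardMax / (1 - p.γ) := by
      calc ∑ i, |(diagonal m *ᵥ u) i| ≤ ∑ i, m i * (p.rewardMax / (1 - p.γ * p.lam)) := by
            refine Finset.sum_le_sum fun i _ => ?_
            rw [mulVec_diagonal, abs_mul, abs_of_nonneg (hm i)]
            exact mul_le_mul_of_nonneg_left (hu i) (hm i)
        _ = _ := by
            rw [← Finset.sum_mul, p.sum_emphasisLimit dμ h1]
            have : 1 - p.γ ≠ 0 := by linarith [p.γ_lt_one]
            have : 1 - p.γ * p.lam ≠ 0 := by linarith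
            field_simp
    refine le_trans ?_ hsum
    rw [EuclideanSpace.norm_eq]
    refine Real.sqrt_le_iff.2 ⟨Finset.sum_nonneg fun _ _ => abs_nonneg _, ?_⟩
    exact Finset.sum_sq_le_sq_sum_of_nonneg fun i _ => abs_nonneg _
  rw [e]
  refine (Matrix.l2_opNorm_mulVec p.featureMatrixᵀ (WithLp.toLp 2 (diagonal m *ᵥ u))).trans ?_
  rw [mul_div_assoc]
  exact mul_le_mul_of_nonneg_left h2 (norm_nonneg _)

/-- Monotonicity at `θ = 0` reads `κ ‖θ*‖² ≤ ⟨c, θ*⟩`, and Cauchy-Schwarz bounds the right side.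
This is why the projection ball contains the fixed point. -/
theorem norm_fixedPoint_le (h0 : ∀ i, 0 ≤ dμ i) (h1 : ∑ i, dμ i = 1) {κ : ℝ}
    (hκ : p.IsMonotonicityConst (p.emphasisLimit dμ) κ) :
    ‖p.fixedPoint (p.emphasisLimit dμ)‖ ≤ p.radius κ := by
  have hc := p.norm_weightMatrix_mulVec_le dμ h0 h1
  set θ := p.fixedPoint (p.emphasisLimit dμ)
  have h2 := hκ.2 0
  have e : p.operator (p.emphasisLimit dμ) 0 =
      -WithLp.toLp 2 (p.weightMatrix (p.emphasisLimit dμ) *ᵥ p.rewardTarget) := by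
    simp [operator]
  rw [e, zero_sub, norm_neg, inner_neg_neg] at h2
  have h3 := h2.trans (real_inner_le_norm _ _)
  have hγ : 0 < 1 - p.γ := by linarith [p.γ_lt_one]
  rw [radius, mul_comm (1 - p.γ) κ, ← div_div, div_right_comm, le_div_iff₀ hκ.1]
  rcases (norm_nonneg θ).eq_or_lt with h | h
  · rw [← h, zero_mul]
    exact (norm_nonneg _).trans hc
  · refine le_trans ?_ hc
    rw [pow_two, ← mul_assoc] at h3
    rw [mul_comm]
    exact le_of_mul_le_mul_right h3 h

end Limit

end Problem

end PerETD

/-! ### Functions of finite histories and the Markov property -/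

namespace PerETD

section History

variable {S A E : Type*}

/-- `H x y` depends only on the states up to time `n` and the actions before time `n`. -/
def Nonanticipating (n : ℕ) (H : (ℕ → S) → (ℕ → A) → E) : Prop :=
  ∀ x x' y y', (∀ k ≤ n, x k = x' k) → (∀ k < n, y k = y' k) → H x y = H x' y'

theorem Nonanticipating.mono {n m : ℕ} {H : (ℕ → S) → (ℕ → A) → E} (h : Nonanticipating n H)
    (hnm : n ≤ m) : Nonanticipating m H := fun x x' y y' hx hy =>
  h x x' y y' (fun k hk => hx k (hk.trans hnm)) fun k hk => hy k (hk.trans_le hnm)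

theorem Nonanticipating.comp {n : ℕ} {E' : Type*} {H : (ℕ → S) → (ℕ → A) → E}
    (h : Nonanticipating n H) (g : E → E') : Nonanticipating n fun x y => g (H x y) :=
  fun x x' y y' hx hy => congrArg g (h x x' y y' hx hy)

theorem Nonanticipating.comp₂ {n : ℕ} {E' E'' : Type*} {H : (ℕ → S) → (ℕ → A) → E}
    {H' : (ℕ → S) → (ℕ → A) → E'} (h : Nonanticipating n H) (h' : Nonanticipating n H')
    (g : E → E' → E'') : Nonanticipating n fun x y => g (H x y) (H' x y) :=
  fun x x' y y' hx hy => congrArg₂ g (h x x' y y' hx hy) (h' x x' y y' hx hy)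

theorem nonanticipating_const (n : ℕ) (c : E) :
    Nonanticipating n fun (_ : ℕ → S) (_ : ℕ → A) => c := fun _ _ _ _ _ _ => rfl

theorem nonanticipating_state {n k : ℕ} (hk : k ≤ n) (g : S → E) :
    Nonanticipating n fun (x : ℕ → S) (_ : ℕ → A) => g (x k) :=
  fun _ _ _ _ hx _ => congrArg g (hx k hk)

theorem nonanticipating_pair {n k : ℕ} (hk : k < n) (g : S → A → E) :
    Nonanticipating n fun (x : ℕ → S) (y : ℕ → A) => g (x k) (y k) :=
  fun _ _ _ _ hx hy => congrArg₂ g (hx k hk.le) (hy k hk)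

/-- Extension of the states of a history of length `n` to a path. -/
def extState {n : ℕ} (x : Fin (n + 1) → S) : ℕ → S :=
  fun k => x ⟨min k n, Nat.lt_succ_of_le (min_le_right k n)⟩

/-- Extension of the actions of a history of length `n` to a path. -/
def extAction (a₀ : A) {n : ℕ} (y : Fin n → A) : ℕ → A :=
  fun k => if h : k < n then y ⟨k, h⟩ else a₀

/-- The event that the history up to time `n` is given by `x, y`. -/
def cylinder {Ω : Type*} (s : ℕ → Ω → S) (a : ℕ → Ω → A) (n : ℕ) (x : ℕ → S) (y : ℕ → A) :
    Set Ω :=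
  {ω | (∀ k ≤ n, s k ω = x k) ∧ ∀ k < n, a k ω = y k}

/-- There are finitely many histories of a given length, so such a function is a finite combination
of indicators of cylinders. Integrability and expectations reduce to finite sums. -/
theorem Nonanticipating.eq_sum [Fintype S] [DecidableEq S] [Fintype A] {Ω : Type*} {s : ℕ → Ω → S}
    {a : ℕ → Ω → A} {n : ℕ} {H : (ℕ → S) → (ℕ → A) → ℝ} (h : Nonanticipating n H) (a₀ : A) (ω : Ω) :
    H (fun n => s n ω) (fun n => a n ω) =
      ∑ z : (Fin (n + 1) → S) × (Fin n → A), (cylinder s a n (extState z.1)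
        (extAction a₀ z.2)).indicator (fun _ => H (extState z.1) (extAction a₀ z.2)) ω := by
  classical
  rw [Finset.sum_eq_single ((fun k : Fin (n + 1) => s k ω), (fun k : Fin n => a k ω))]
  · have hmem : ω ∈ cylinder s a n (extState fun k : Fin (n + 1) => s k ω)
        (extAction a₀ fun k : Fin n => a k ω) := by
      refine ⟨fun k hk => ?_, fun k hk => ?_⟩
      · simp [extState, hk]
      · simp [extAction, hk]
    rw [Set.indicator_of_mem hmem]
    exact h _ _ _ _ hmem.1 hmem.2
  · rintro ⟨x, y⟩ - hne
    refine Set.indicator_of_notMem (fun hmem => hne ?_) _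
    ext k
    · have := hmem.1 k (Nat.lt_succ_iff.1 k.2)
      simp [extState, Nat.lt_succ_iff.1 k.2] at this
      exact this.symm
    · have := hmem.2 k k.2
      simp [extAction] at this
      exact this.symm
  · simp

end History

variable {S A : Type*} [Fintype S] [DecidableEq S] [Fintype A] {d : ℕ}
variable {p : Problem S A d} {Ω : Type w} [MeasurableSpace Ω] {Pr : Measure Ω}
  {s : ℕ → Ω → S} {a : ℕ → Ω → A}

/-- The expectation of a function of the trajectory. -/
noncomputable def mean (Pr : Measure Ω) (s : ℕ → Ω → S) (a : ℕ → Ω → A)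
    (H : (ℕ → S) → (ℕ → A) → ℝ) : ℝ :=
  ∫ ω, H (fun n => s n ω) (fun n => a n ω) ∂Pr

namespace Problem.IsTrajectory

theorem measurableSet_cylinder (h : p.IsTrajectory Pr s a) (n : ℕ) (x : ℕ → S) (y : ℕ → A) :
    MeasurableSet (cylinder s a n x y) := by
  have : cylinder s a n x y =
      (⋂ k ∈ Set.Iic n, {ω | s k ω = x k}) ∩ ⋂ k ∈ Set.Iio n, {ω | a k ω = y k} := by
    ext ω; simp [cylinder]
  rw [this]
  exact (MeasurableSet.biInter (Set.to_countable _) fun k _ => h.measurable_state k _).inter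
    (MeasurableSet.biInter (Set.to_countable _) fun k _ => h.measurable_action k _)

theorem nonempty_action (h : p.IsTrajectory Pr s a) : Nonempty A := by
  have := h.isProbabilityMeasure
  obtain ⟨ω⟩ := Pr.nonempty_of_neZero
  exact ⟨a 0 ω⟩

theorem nonempty_state (h : p.IsTrajectory Pr s a) : Nonempty S := by
  have := h.isProbabilityMeasure
  obtain ⟨ω⟩ := Pr.nonempty_of_neZero
  exact ⟨s 0 ω⟩

/-- The law of the trajectory also fixes the action at time `n`; a cylinder leaves it free, so it is
summed out. -/
theorem measureReal_cylinder (h : p.IsTrajectory Pr s a) (n : ℕ) (x : ℕ → S) (y : ℕ → A) :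
    Pr.real (cylinder s a n x y) = Pr.real {ω | s 0 ω = x 0} *
      ∏ k ∈ Finset.range n, (p.behavior.prob (x k) (y k) * p.trans (x k) (y k) (x (k + 1))) := by
  classical
  have := h.isProbabilityMeasure
  have hset : ∀ α, {ω | ∀ k ≤ n, s k ω = x k ∧ a k ω = Function.update y n α k} =
      cylinder s a n x y ∩ {ω | a n ω = α} := fun α => by
    ext ω
    simp only [cylinder, Set.mem_ofPred_eq, Set.mem_inter_iff]
    constructor
    · intro hω
      refine ⟨⟨fun k hk => (hω k hk).1, fun k hk => ?_⟩, ?_⟩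
      · rw [(hω k hk.le).2, Function.update_of_ne hk.ne]
      · rw [(hω n le_rfl).2, Function.update_self]
    · rintro ⟨⟨h1, h2⟩, h3⟩ k hk
      refine ⟨h1 k hk, ?_⟩
      rcases hk.eq_or_lt with rfl | hk
      · rw [Function.update_self, h3]
      · rw [Function.update_of_ne hk.ne, h2 k hk]
  have hU : cylinder s a n x y = ⋃ α, (cylinder s a n x y ∩ {ω | a n ω = α}) := by
    ext ω; simp
  rw [hU, measureReal_iUnion_fintype]
  · calc _ = ∑ α, (Pr.real {ω | s 0 ω = x 0} * ∏ k ∈ Finset.range n,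
          (p.behavior.prob (x k) (y k) * p.trans (x k) (y k) (x (k + 1)))) *
            p.behavior.prob (x n) α := by
          refine Finset.sum_congr rfl fun α _ => ?_
          rw [← hset, h.law, Finset.prod_range_succ, Function.update_self, Finset.prod_mul_distrib]
          have e : ∀ k ∈ Finset.range n, Function.update y n α k = y k := fun k hk =>
            Function.update_of_ne (Finset.mem_range.1 hk).ne _ _
          have e1 : ∏ k ∈ Finset.range n, p.behavior.prob (x k) (Function.update y n α k) =
              ∏ k ∈ Finset.range n, p.behavior.prob (x k) (y k) :=
            Finset.prod_congr rfl fun k hk => by rw [e k hk]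
          have e2 : ∏ k ∈ Finset.range n, p.trans (x k) (Function.update y n α k) (x (k + 1)) =
              ∏ k ∈ Finset.range n, p.trans (x k) (y k) (x (k + 1)) :=
            Finset.prod_congr rfl fun k hk => by rw [e k hk]
          rw [e1, e2]
          ring
      _ = _ := by rw [← Finset.mul_sum, p.behavior.prob_sum, mul_one]
  · intro α β hαβ
    refine Set.disjoint_left.2 fun ω h1 h2 => hαβ ?_
    rw [← h1.2, ← h2.2]
  · exact fun α => (h.measurableSet_cylinder n x y).inter (h.measurable_action n α)

theorem integrable (h : p.IsTrajectory Pr s a) {n : ℕ} {H : (ℕ → S) → (ℕ → A) → ℝ}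
    (hH : Nonanticipating n H) :
    Integrable (fun ω => H (fun n => s n ω) (fun n => a n ω)) Pr := by
  have := h.isProbabilityMeasure
  obtain ⟨a₀⟩ := h.nonempty_action
  simp_rw [hH.eq_sum a₀]
  exact integrable_finsetSum _ fun z _ =>
    (integrable_const _).indicator (h.measurableSet_cylinder _ _ _)

theorem mean_eq_sum (h : p.IsTrajectory Pr s a) {n : ℕ} {H : (ℕ → S) → (ℕ → A) → ℝ}
    (hH : Nonanticipating n H) (a₀ : A) :
    mean Pr s a H = ∑ z : (Fin (n + 1) → S) × (Fin n → A),
      Pr.real (cylinder s a n (extState z.1) (extAction a₀ z.2)) *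
        H (extState z.1) (extAction a₀ z.2) := by
  have := h.isProbabilityMeasure
  unfold mean
  simp_rw [hH.eq_sum a₀]
  rw [integral_finsetSum _ fun z _ =>
    (integrable_const _).indicator (h.measurableSet_cylinder _ _ _)]
  refine Finset.sum_congr rfl fun z _ => ?_
  rw [integral_indicator_const _ (h.measurableSet_cylinder _ _ _), smul_eq_mul]

theorem measureReal_cylinder_succ (h : p.IsTrajectory Pr s a) (n : ℕ) (x : ℕ → S) (y : ℕ → A)
    (α : A) (j : S) :
    Pr.real (cylinder s a n x y ∩ {ω | a n ω = α} ∩ {ω | s (n + 1) ω = j}) =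
      Pr.real (cylinder s a n x y) * (p.behavior.prob (x n) α * p.trans (x n) α j) := by
  classical
  -- Prescribing the next action and state gives a cylinder of length `n + 1` for the modified path.
  have hset : cylinder s a n x y ∩ {ω | a n ω = α} ∩ {ω | s (n + 1) ω = j} =
      cylinder s a (n + 1) (Function.update x (n + 1) j) (Function.update y n α) := by
    ext ω
    simp only [cylinder, Set.mem_ofPred_eq, Set.mem_inter_iff]
    constructor
    · rintro ⟨⟨⟨h1, h2⟩, h3⟩, h4⟩
      refine ⟨fun k hk => ?_, fun k hk => ?_⟩
      · rcases hk.eq_or_lt with rfl | hk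
        · rw [Function.update_self, h4]
        · rw [Function.update_of_ne hk.ne, h1 k (Nat.lt_succ_iff.1 hk)]
      · rcases (Nat.lt_succ_iff.1 hk).eq_or_lt with rfl | hk
        · rw [Function.update_self, h3]
        · rw [Function.update_of_ne hk.ne, h2 k hk]
    · rintro ⟨h1, h2⟩
      refine ⟨⟨⟨fun k hk => ?_, fun k hk => ?_⟩, ?_⟩, ?_⟩
      · rw [h1 k (by omega), Function.update_of_ne (by omega)]
      · rw [h2 k (by omega), Function.update_of_ne (by omega)]
      · rw [h2 n (by omega), Function.update_self]
      · rw [h1 (n + 1) le_rfl, Function.update_self]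
  rw [hset, h.measureReal_cylinder, h.measureReal_cylinder, Finset.prod_range_succ]
  have e1 : ∀ k ≤ n, Function.update x (n + 1) j k = x k := fun k hk =>
    Function.update_of_ne (by omega) _ _
  have e2 : ∀ k < n, Function.update y n α k = y k := fun k hk =>
    Function.update_of_ne (by omega) _ _
  rw [e1 0 (Nat.zero_le _), e1 n le_rfl, Function.update_self, Function.update_self, ← mul_assoc]
  congr 2
  refine Finset.prod_congr rfl fun k hk => ?_
  have hk := Finset.mem_range.1 hk
  rw [e1 k hk.le, e2 k hk, e1 (k + 1) hk]

/-- The Markov property: averaging over the next action and state. -/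
theorem mean_mul_step (h : p.IsTrajectory Pr s a) {n : ℕ} {H : (ℕ → S) → (ℕ → A) → ℝ}
    (hH : Nonanticipating n H) (G : S → A → S → ℝ) :
    mean Pr s a (fun x y => H x y * G (x n) (y n) (x (n + 1))) =
      mean Pr s a fun x y => H x y *
        ∑ α, p.behavior.prob (x n) α * ∑ j, p.trans (x n) α j * G (x n) α j := by
  classical
  have := h.isProbabilityMeasure
  obtain ⟨a₀⟩ := h.nonempty_action
  rw [h.mean_eq_sum (hH.comp₂ (nonanticipating_state le_rfl fun i =>
    ∑ α, p.behavior.prob i α * ∑ j, p.trans i α j * G i α j) (· * ·)) a₀]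
  set X : (Fin (n + 1) → S) × (Fin n → A) → ℕ → S := fun z => extState z.1
  set Y : (Fin (n + 1) → S) × (Fin n → A) → ℕ → A := fun z => extAction a₀ z.2
  have hmeas : ∀ z α j, MeasurableSet
      (cylinder s a n (X z) (Y z) ∩ {ω | a n ω = α} ∩ {ω | s (n + 1) ω = j}) := fun z α j =>
    ((h.measurableSet_cylinder _ _ _).inter (h.measurable_action _ _)).inter
      (h.measurable_state _ _)
  have hpt : ∀ ω, H (fun n => s n ω) (fun n => a n ω) * G (s n ω) (a n ω) (s (n + 1) ω) =
      ∑ z, ∑ α, ∑ j, (cylinder s a n (X z) (Y z) ∩ {ω | a n ω = α} ∩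
        {ω | s (n + 1) ω = j}).indicator (fun _ => H (X z) (Y z) * G (X z n) α j) ω := fun ω => by
    rw [hH.eq_sum a₀, Finset.sum_mul]
    refine Finset.sum_congr rfl fun z _ => ?_
    by_cases hω : ω ∈ cylinder s a n (X z) (Y z)
    · rw [Set.indicator_of_mem hω]
      rw [Finset.sum_eq_single (a n ω), Finset.sum_eq_single (s (n + 1) ω)]
      · have hmem : ω ∈ cylinder s a n (X z) (Y z) ∩ {ω' | a n ω' = a n ω} ∩
            {ω' | s (n + 1) ω' = s (n + 1) ω} := ⟨⟨hω, rfl⟩, rfl⟩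
        rw [Set.indicator_of_mem hmem, ← hω.1 n le_rfl]
      · exact fun j _ hj => Set.indicator_of_notMem (fun hm => hj hm.2.symm) _
      · simp
      · exact fun α _ hα => Finset.sum_eq_zero fun j _ =>
          Set.indicator_of_notMem (fun hm => hα hm.1.2.symm) _
      · simp
    · rw [Set.indicator_of_notMem hω, zero_mul]
      symm
      exact Finset.sum_eq_zero fun α _ => Finset.sum_eq_zero fun j _ =>
        Set.indicator_of_notMem (fun hm => hω hm.1.1) _
  have hint : ∀ z α j, Integrable ((cylinder s a n (X z) (Y z) ∩ {ω | a n ω = α} ∩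
        {ω | s (n + 1) ω = j}).indicator fun _ => H (X z) (Y z) * G (X z n) α j) Pr :=
    fun z α j => (integrable_const _).indicator (hmeas z α j)
  unfold mean
  simp_rw [hpt]
  rw [integral_finsetSum _ fun z _ => integrable_finsetSum _ fun α _ =>
    integrable_finsetSum _ fun j _ => hint z α j]
  refine Finset.sum_congr rfl fun z _ => ?_
  rw [integral_finsetSum _ fun α _ => integrable_finsetSum _ fun j _ => hint z α j,
    Finset.mul_sum, Finset.mul_sum]
  refine Finset.sum_congr rfl fun α _ => ?_
  rw [integral_finsetSum _ fun j _ => hint z α j, Finset.mul_sum, Finset.mul_sum, Finset.mul_sum]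
  refine Finset.sum_congr rfl fun j _ => ?_
  rw [integral_indicator_const _ (hmeas z α j), h.measureReal_cylinder_succ, smul_eq_mul]
  ring

end Problem.IsTrajectory

end PerETD

/-! ### Importance ratios, traces and expectations along a trajectory -/

namespace PerETD

variable {S A : Type*} [Fintype S] [DecidableEq S] [Fintype A] {d : ℕ}
variable {p : Problem S A d} {Ω : Type w} [MeasurableSpace Ω] {Pr : Measure Ω}
  {s : ℕ → Ω → S} {a : ℕ → Ω → A}

namespace Problem

theorem behavior_mul_ratio (hcov : p.Coverage) (i : S) (α : A) :
    p.behavior.prob i α * p.ratio i α = p.target.prob i α := by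
  unfold ratio
  rcases (p.target.prob_nonneg i α).eq_or_lt with h | h
  · rw [← h, zero_div, mul_zero]
  · rw [mul_div_cancel₀ _ (hcov i α h).ne']

theorem ratio_nonneg (i : S) (α : A) : 0 ≤ p.ratio i α :=
  div_nonneg (p.target.prob_nonneg i α) (p.behavior.prob_nonneg i α)

theorem ratio_le_ratioMax (i : S) (α : A) : p.ratio i α ≤ p.ratioMax :=
  le_ciSup (f := fun x : S × A => p.ratio x.1 x.2) (Set.finite_range _).bddAbove (i, α)

theorem one_le_ratioMax [Nonempty S] (hcov : p.Coverage) : 1 ≤ p.ratioMax := by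
  obtain ⟨i⟩ := ‹Nonempty S›
  calc 1 = ∑ α, p.behavior.prob i α * p.ratio i α := by
        simp only [behavior_mul_ratio hcov, p.target.prob_sum]
    _ ≤ ∑ α, p.behavior.prob i α * p.ratioMax := Finset.sum_le_sum fun α _ =>
        mul_le_mul_of_nonneg_left (ratio_le_ratioMax i α) (p.behavior.prob_nonneg i α)
    _ = p.ratioMax := by rw [← Finset.sum_mul, p.behavior.prob_sum, one_mul]

theorem nonanticipating_followOn (p : Problem S A d) (k τ : ℕ) :
    Nonanticipating (k + τ) fun x y => p.followOn x y k τ := by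
  induction τ with
  | zero => exact nonanticipating_const _ _
  | succ τ ih =>
    exact ((nonanticipating_pair (by omega) fun i α => p.γ * p.ratio i α).comp₂
      (ih.mono (by omega)) (· * ·)).comp (· + 1)

theorem nonanticipating_emphasis (p : Problem S A d) (k τ : ℕ) :
    Nonanticipating (k + τ) fun x y => p.emphasis x y k τ :=
  (p.nonanticipating_followOn k τ).comp fun F => p.lam + (1 - p.lam) * F

theorem nonanticipating_eligibility (p : Problem S A d) (k τ : ℕ) :
    Nonanticipating (k + τ) fun x y => p.eligibility x y k τ := by
  induction τ with
  | zero => exact nonanticipating_state (by omega) p.φ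
  | succ τ ih =>
    exact ((nonanticipating_pair (by omega) fun i α => p.γ * p.lam * p.ratio i α).comp₂
      (ih.mono (by omega)) (· • ·)).comp₂
      ((p.nonanticipating_emphasis k (τ + 1)).comp₂
        (nonanticipating_state (k := k + (τ + 1)) le_rfl p.φ) (· • ·)) (· + ·)

theorem one_le_followOn (p : Problem S A d) (x : ℕ → S) (y : ℕ → A) (k τ : ℕ) :
    1 ≤ p.followOn x y k τ := by
  induction τ with
  | zero => exact le_rfl
  | succ τ ih =>
    have := mul_nonneg (mul_nonneg p.γ_pos.le (p.ratio_nonneg (x (k + τ)) (y (k + τ))))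
      (zero_le_one.trans ih)
    rw [followOn]
    linarith

theorem abs_emphasis_le (p : Problem S A d) (x : ℕ → S) (y : ℕ → A) (k τ : ℕ) :
    |p.emphasis x y k τ| ≤ p.followOn x y k τ := by
  have h := p.one_le_followOn x y k τ
  have h1 := p.lam_nonneg
  have h2 := p.lam_le_one
  rw [emphasis, abs_of_nonneg (by nlinarith)]
  nlinarith

/-- A common bound for the norms of the features. -/
noncomputable def featureBound (p : Problem S A d) : ℝ := ∑ i, ‖p.φ i‖

theorem featureBound_nonneg : 0 ≤ p.featureBound := Finset.sum_nonneg fun _ _ => norm_nonneg _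

theorem norm_φ_le (i : S) : ‖p.φ i‖ ≤ p.featureBound :=
  Finset.single_le_sum (f := fun i => ‖p.φ i‖) (fun _ _ => norm_nonneg _) (Finset.mem_univ i)

theorem abs_φ_le (i : S) (l : Fin d) : |p.φ i l| ≤ p.featureBound :=
  (PiLp.norm_apply_le (p.φ i) l).trans (norm_φ_le i)

end Problem

namespace Problem.IsTrajectory

section Mean

variable (h : p.IsTrajectory Pr s a) {n : ℕ} {H H' : (ℕ → S) → (ℕ → A) → ℝ}

include h

theorem mean_add (hH : Nonanticipating n H) (hH' : Nonanticipating n H') :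
    mean Pr s a (fun x y => H x y + H' x y) = mean Pr s a H + mean Pr s a H' :=
  integral_add (h.integrable hH) (h.integrable hH')

theorem mean_sub (hH : Nonanticipating n H) (hH' : Nonanticipating n H') :
    mean Pr s a (fun x y => H x y - H' x y) = mean Pr s a H - mean Pr s a H' :=
  integral_sub (h.integrable hH) (h.integrable hH')

omit h in
theorem mean_const_mul (c : ℝ) :
    mean Pr s a (fun x y => c * H x y) = c * mean Pr s a H :=
  integral_const_mul _ _

omit h in
theorem mean_mul_const (c : ℝ) :
    mean Pr s a (fun x y => H x y * c) = mean Pr s a H * c :=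
  integral_mul_const _ _

theorem mean_const (c : ℝ) : mean Pr s a (fun _ _ => c) = c := by
  have := h.isProbabilityMeasure
  simp [mean]

theorem mean_sum {ι : Type*} (t : Finset ι) {K : ι → (ℕ → S) → (ℕ → A) → ℝ}
    (hK : ∀ i, Nonanticipating n (K i)) :
    mean Pr s a (fun x y => ∑ i ∈ t, K i x y) = ∑ i ∈ t, mean Pr s a (K i) :=
  integral_finsetSum _ fun i _ => h.integrable (hK i)

theorem mean_mono (hH : Nonanticipating n H) (hH' : Nonanticipating n H')
    (hle : ∀ x y, H x y ≤ H' x y) : mean Pr s a H ≤ mean Pr s a H' :=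
  integral_mono (h.integrable hH) (h.integrable hH') fun _ => hle _ _

omit h in
theorem mean_nonneg (hH : ∀ x y, 0 ≤ H x y) : 0 ≤ mean Pr s a H :=
  integral_nonneg fun _ => hH _ _

omit h in
theorem abs_mean_le : |mean Pr s a H| ≤ mean Pr s a fun x y => |H x y| :=
  abs_integral_le_integral_abs

/-- Importance sampling turns the behavior policy into the target policy. -/
theorem mean_mul_ratio_step (hcov : p.Coverage) (hH : Nonanticipating n H) (G : S → A → S → ℝ) :
    mean Pr s a (fun x y => H x y * (p.ratio (x n) (y n) * G (x n) (y n) (x (n + 1)))) =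
      mean Pr s a fun x y => H x y *
        ∑ α, p.target.prob (x n) α * ∑ j, p.trans (x n) α j * G (x n) α j := by
  rw [h.mean_mul_step hH fun i α j => p.ratio i α * G i α j]
  congr 1
  funext x y
  congr 1
  refine Finset.sum_congr rfl fun α _ => ?_
  rw [← behavior_mul_ratio hcov, mul_assoc, Finset.mul_sum (a := p.ratio _ _)]
  congr 1
  exact Finset.sum_congr rfl fun j _ => by ring

/-- One factor of the ratio changes the action law to the target policy and only the other is
bounded by `ρ_max`; bounding both would cost `ρ_max²` per step. -/
theorem mean_mul_ratio_sq_le (hcov : p.Coverage) (hH : Nonanticipating n H)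
    (hH0 : ∀ x y, 0 ≤ H x y) :
    mean Pr s a (fun x y => H x y * p.ratio (x n) (y n) ^ 2) ≤ p.ratioMax * mean Pr s a H := by
  have e := h.mean_mul_ratio_step hcov hH fun i α _ => p.ratio i α
  simp only [← pow_two] at e
  rw [e, ← mean_const_mul]
  refine h.mean_mono (hH.comp₂ (nonanticipating_state le_rfl fun i =>
    ∑ α, p.target.prob i α * ∑ j, p.trans i α j * p.ratio i α) (· * ·))
    (hH.comp (p.ratioMax * ·)) fun x y => ?_
  rw [mul_comm p.ratioMax]
  refine mul_le_mul_of_nonneg_left ?_ (hH0 x y)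
  calc _ ≤ ∑ α, p.target.prob (x n) α * p.ratioMax := by
        refine Finset.sum_le_sum fun α _ => ?_
        rw [← Finset.sum_mul, p.trans_sum, one_mul]
        exact mul_le_mul_of_nonneg_left (ratio_le_ratioMax _ _) (p.target.prob_nonneg _ _)
    _ = _ := by rw [← Finset.sum_mul, p.target.prob_sum, one_mul]

end Mean

end Problem.IsTrajectory

/-! ### Occupation vectors and their linear recursions -/

/-- The occupation vector `i ↦ E[H 1{s_n = i}]`. -/
noncomputable def occupation (Pr : Measure Ω) (s : ℕ → Ω → S) (a : ℕ → Ω → A) (n : ℕ)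
    (H : (ℕ → S) → (ℕ → A) → ℝ) : S → ℝ :=
  fun i => mean Pr s a fun x y => H x y * if x n = i then 1 else 0

namespace Problem.IsTrajectory

section Occupation

variable (h : p.IsTrajectory Pr s a) {n : ℕ} {H H' : (ℕ → S) → (ℕ → A) → ℝ}

include h

theorem mean_mul_state (hH : Nonanticipating n H) (K : S → ℝ) :
    mean Pr s a (fun x y => H x y * K (x n)) = occupation Pr s a n H ⬝ᵥ K := by
  simp only [dotProduct, occupation, ← mean_mul_const]
  rw [← h.mean_sum (n := n) Finset.univ
    (K := fun i x y => (H x y * if x n = i then 1 else 0) * K i) fun i =>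
    (hH.comp₂ (nonanticipating_state le_rfl fun j => if j = i then (1 : ℝ) else 0)
      (· * ·)).comp (· * K i)]
  congr 1
  funext x y
  simp

theorem sum_occupation (hH : Nonanticipating n H) :
    ∑ i, occupation Pr s a n H i = mean Pr s a H := by
  have := h.mean_mul_state hH fun _ => 1
  simpa [dotProduct] using this.symm

theorem l1_occupation_le (hH : Nonanticipating n H) :
    l1 (occupation Pr s a n H) ≤ mean Pr s a fun x y => |H x y| := by
  rw [← h.sum_occupation (hH.comp abs)]
  refine Finset.sum_le_sum fun i _ => abs_mean_le.trans (le_of_eq ?_)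
  unfold occupation
  congr 1
  funext x y
  by_cases hx : x n = i <;> simp [hx]

theorem occupation_add (hH : Nonanticipating n H) (hH' : Nonanticipating n H') :
    occupation Pr s a n (fun x y => H x y + H' x y) =
      occupation Pr s a n H + occupation Pr s a n H' := by
  funext i
  have hi : Nonanticipating n fun (x : ℕ → S) (_ : ℕ → A) => if x n = i then (1 : ℝ) else 0 :=
    nonanticipating_state le_rfl fun j => if j = i then (1 : ℝ) else 0
  simp only [occupation, add_mul, Pi.add_apply]
  exact h.mean_add (hH.comp₂ hi (· * ·)) (hH'.comp₂ hi (· * ·))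

omit h in
theorem occupation_const_mul (c : ℝ) :
    occupation Pr s a n (fun x y => c * H x y) = c • occupation Pr s a n H := by
  funext i
  simp only [occupation, mul_assoc, Pi.smul_apply, smul_eq_mul]
  exact mean_const_mul c

omit h in
theorem occupation_mul_state (K : S → ℝ) :
    occupation Pr s a n (fun x y => H x y * K (x n)) =
      fun i => occupation Pr s a n H i * K i := by
  funext i
  simp only [occupation, ← mean_mul_const]
  congr 1
  funext x y
  by_cases hx : x n = i
  · simp [hx]
  · simp [hx]

theorem occupation_succ (hH : Nonanticipating n H) :
    occupation Pr s a (n + 1) H = occupation Pr s a n H ᵥ* p.chain p.behavior := by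
  funext j
  have e := h.mean_mul_step hH fun _ _ j' => if j' = j then 1 else 0
  refine e.trans ?_
  rw [h.mean_mul_state hH fun i => ∑ α, p.behavior.prob i α *
    ∑ j', p.trans i α j' * if j' = j then 1 else 0]
  simp [vecMul, dotProduct, chain]

theorem occupation_ratio_succ (hcov : p.Coverage) (hH : Nonanticipating n H) :
    occupation Pr s a (n + 1) (fun x y => H x y * p.ratio (x n) (y n)) =
      occupation Pr s a n H ᵥ* p.chain p.target := by
  funext j
  have e := h.mean_mul_ratio_step hcov hH fun _ _ j' => if j' = j then 1 else 0
  simp only [← mul_assoc] at e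
  refine e.trans ?_
  rw [h.mean_mul_state hH fun i => ∑ α, p.target.prob i α *
    ∑ j', p.trans i α j' * if j' = j then 1 else 0]
  simp [vecMul, dotProduct, chain]

theorem occupation_add_eq {k : ℕ} (hH : Nonanticipating k H) (τ : ℕ) :
    occupation Pr s a (k + τ) H = occupation Pr s a k H ᵥ* p.chain p.behavior ^ τ := by
  induction τ with
  | zero => simp
  | succ τ ih =>
    rw [← add_assoc, h.occupation_succ (hH.mono (Nat.le_add_right k τ)), ih, vecMul_vecMul,
      pow_succ]

/-- The occupation at time `k` is a signed initial measure of mass `E[H]` and `ℓ¹` norm at most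
`E|H|`. An error proportional to `E|H|` is what later permits weights depending on the iterate. -/
theorem l1_occupation_sub_le {ν : S → ℝ} {C χ : ℝ}
    (hge : GeometricallyErgodic (p.chain p.behavior) ν C χ) {k : ℕ}
    (hH : Nonanticipating k H) (τ : ℕ) :
    l1 (occupation Pr s a (k + τ) H - mean Pr s a H • ν) ≤
      C * χ ^ τ * mean Pr s a fun x y => |H x y| := by
  rw [h.occupation_add_eq hH, ← h.sum_occupation hH, mul_comm]
  refine (l1_vecMul_pow_sub_le hge _ τ).trans ?_
  exact mul_le_mul_of_nonneg_right (h.l1_occupation_le hH)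
    (mul_nonneg hge.1 (pow_nonneg hge.2.1.le _))

/-! ### Traces weighted by a function `W` of the history at the start of the period -/

variable {k : ℕ} {W : (ℕ → S) → (ℕ → A) → ℝ}

/-- The term `γρF` moves the vector by `γP_π`; the restart term `1` contributes the occupation of
the weight alone, which evolves under `P_μ`. -/
theorem occupation_followOn_succ (hcov : p.Coverage) (hW : Nonanticipating k W) (τ : ℕ) :
    occupation Pr s a (k + (τ + 1)) (fun x y => W x y * p.followOn x y k (τ + 1)) =
      p.γ • (occupation Pr s a (k + τ) (fun x y => W x y * p.followOn x y k τ) ᵥ*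
        p.chain p.target) + occupation Pr s a (k + (τ + 1)) W := by
  have hF : Nonanticipating (k + τ) fun x y => W x y * p.followOn x y k τ :=
    (hW.mono (Nat.le_add_right _ _)).comp₂ (p.nonanticipating_followOn k τ) (· * ·)
  have e : (fun x y => W x y * p.followOn x y k (τ + 1)) = fun x y =>
      p.γ * (W x y * p.followOn x y k τ * p.ratio (x (k + τ)) (y (k + τ))) + W x y := by
    funext x y
    rw [followOn]
    ring
  rw [e, h.occupation_add (n := k + (τ + 1)) _ (hW.mono (Nat.le_add_right _ _)),
    occupation_const_mul, ← add_assoc k, h.occupation_ratio_succ hcov hF]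
  exact ((hF.mono (by omega)).comp₂ (nonanticipating_pair (k := k + τ) (by omega) p.ratio)
    (· * ·)).comp (p.γ * ·)

theorem occupation_emphasis (hW : Nonanticipating k W) (τ : ℕ) :
    occupation Pr s a (k + τ) (fun x y => W x y * p.emphasis x y k τ) =
      p.lam • occupation Pr s a (k + τ) W + (1 - p.lam) •
        occupation Pr s a (k + τ) (fun x y => W x y * p.followOn x y k τ) := by
  have hW' := hW.mono (Nat.le_add_right k τ)
  have e : (fun x y => W x y * p.emphasis x y k τ) = fun x y =>
      p.lam * W x y + (1 - p.lam) * (W x y * p.followOn x y k τ) := by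
    funext x y
    rw [emphasis]
    ring
  rw [e, h.occupation_add (n := k + τ) (hW'.comp (p.lam * ·))
    ((hW'.comp₂ (p.nonanticipating_followOn k τ) (· * ·)).comp ((1 - p.lam) * ·)),
    occupation_const_mul, occupation_const_mul]

theorem occupation_eligibility_succ (hcov : p.Coverage) (hW : Nonanticipating k W) (τ : ℕ)
    (l : Fin d) :
    occupation Pr s a (k + (τ + 1)) (fun x y => W x y * p.eligibility x y k (τ + 1) l) =
      (p.γ * p.lam) • (occupation Pr s a (k + τ) (fun x y => W x y * p.eligibility x y k τ l) ᵥ*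
        p.chain p.target) + fun i => occupation Pr s a (k + (τ + 1))
          (fun x y => W x y * p.emphasis x y k (τ + 1)) i * p.φ i l := by
  have hF : Nonanticipating (k + τ) fun x y => W x y * p.eligibility x y k τ l :=
    (hW.mono (Nat.le_add_right _ _)).comp₂ (p.nonanticipating_eligibility k τ) (· * · l)
  have e : (fun x y => W x y * p.eligibility x y k (τ + 1) l) = fun x y =>
      (p.γ * p.lam) * (W x y * p.eligibility x y k τ l * p.ratio (x (k + τ)) (y (k + τ))) +
        W x y * p.emphasis x y k (τ + 1) * p.φ (x (k + (τ + 1))) l := by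
    funext x y
    simp only [eligibility, PiLp.add_apply, PiLp.smul_apply, smul_eq_mul]
    ring
  rw [e, h.occupation_add (n := k + (τ + 1)), occupation_const_mul,
    occupation_mul_state (K := fun i => p.φ i l), ← add_assoc k,
    h.occupation_ratio_succ hcov hF]
  · exact ((hF.mono (by omega)).comp₂ (nonanticipating_pair (k := k + τ) (by omega) p.ratio)
      (· * ·)).comp (p.γ * p.lam * ·)
  · exact ((hW.mono (Nat.le_add_right _ _)).comp₂ (p.nonanticipating_emphasis k (τ + 1))
      (· * ·)).comp₂ (nonanticipating_state le_rfl fun i => p.φ i l) (· * ·)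

end Occupation

end Problem.IsTrajectory

/-- A contraction with rate `g < ζ` and forcing of order `ζ ^ τ` decays like `ζ ^ τ`. -/
theorem le_of_geometric_recursion {u : ℕ → ℝ} {g ζ c c₀ V : ℝ} (hg : 0 ≤ g) (hgζ : g < ζ)
    (hc : 0 ≤ c) (hc₀ : 0 ≤ c₀) (hV : 0 ≤ V) (h0 : u 0 ≤ c₀ * V)
    (hs : ∀ τ, u (τ + 1) ≤ g * u τ + c * ζ ^ (τ + 1) * V) (τ : ℕ) :
    u τ ≤ (c₀ + c * ζ / (ζ - g)) * ζ ^ τ * V := by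
  have hζ : 0 < ζ := hg.trans_lt hgζ
  have hd : 0 < ζ - g := sub_pos.2 hgζ
  induction τ with
  | zero =>
    refine h0.trans ?_
    rw [pow_zero, mul_one]
    exact mul_le_mul_of_nonneg_right (le_add_of_nonneg_right (by positivity)) hV
  | succ τ ih =>
    refine (hs τ).trans ?_
    have h1 := mul_le_mul_of_nonneg_left ih hg
    have h2 : c * ζ / (ζ - g) * (ζ - g) = c * ζ := div_mul_cancel₀ _ hd.ne'
    -- Exactly the slack left by the induction step, as `h4` records.
    have h3 : 0 ≤ c₀ * (ζ - g) * (ζ ^ τ * V) := by positivity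
    have h4 : (c₀ + c * ζ / (ζ - g)) * ζ ^ (τ + 1) * V =
        g * ((c₀ + c * ζ / (ζ - g)) * ζ ^ τ * V) + c * ζ ^ (τ + 1) * V +
          c₀ * (ζ - g) * (ζ ^ τ * V) := by
      rw [pow_succ]
      linear_combination (ζ ^ τ * V) * h2
    linarith

/-! ### Geometric convergence of the trace-weighted occupations -/

namespace Problem

/-- Geometric convergence of the emphasis-weighted occupation. -/
theorem exists_l1_occupation_emphasis_le (hcov : p.Coverage) {dμ : S → ℝ} {C χ ζ : ℝ}
    (hge : GeometricallyErgodic (p.chain p.behavior) dμ C χ) (hχ : χ ≤ ζ) (hγ : p.γ < ζ) :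
    ∃ D : ℝ, 0 ≤ D ∧ ∀ {Ω : Type w} [MeasurableSpace Ω] {Pr : Measure Ω} {s : ℕ → Ω → S}
      {a : ℕ → Ω → A}, p.IsTrajectory Pr s a → ∀ (k : ℕ) (W : (ℕ → S) → (ℕ → A) → ℝ),
      Nonanticipating k W → ∀ τ : ℕ,
      l1 (occupation Pr s a (k + τ) (fun x y => W x y * p.emphasis x y k τ) -
        mean Pr s a W • p.emphasisLimit dμ) ≤
          D * ζ ^ τ * mean Pr s a fun x y => |W x y| := by
  have hζ : 0 < ζ := p.γ_pos.trans hγ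
  have hC := hge.1
  have hf := l1_nonneg (p.followOnLimit dμ)
  have hd : 0 < ζ - p.γ := sub_pos.2 hγ
  -- The constant of `le_of_geometric_recursion`: the initial distance to the limit plus the mixing
  -- error accumulated at contraction rate `γ`.
  set D := (1 + l1 (p.followOnLimit dμ)) + C * ζ / (ζ - p.γ)
  have hD : 0 ≤ D := by positivity
  refine ⟨C + D, by positivity, fun {Ω} _ {Pr s a} h k W hW τ => ?_⟩
  set V := mean Pr s a fun x y => |W x y|
  have hV : 0 ≤ V := IsTrajectory.mean_nonneg fun _ _ => abs_nonneg _
  have hq : ∀ τ, l1 (occupation Pr s a (k + τ) W - mean Pr s a W • dμ) ≤ C * ζ ^ τ * V := by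
    intro τ
    refine (h.l1_occupation_sub_le hge hW τ).trans ?_
    gcongr
    exact hge.2.1.le
  have hF : l1 (occupation Pr s a (k + τ) (fun x y => W x y * p.followOn x y k τ) -
      mean Pr s a W • p.followOnLimit dμ) ≤ D * ζ ^ τ * V := by
    refine le_of_geometric_recursion (u := fun τ => l1 (occupation Pr s a (k + τ)
      (fun x y => W x y * p.followOn x y k τ) - mean Pr s a W • p.followOnLimit dμ))
      p.γ_pos.le hγ hC (by positivity) hV ?_ (fun τ => ?_) τ
    · simp only [followOn, mul_one, add_zero]
      rw [sub_eq_add_neg, ← neg_smul]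
      refine (l1_add_le _ _).trans ?_
      rw [l1_smul, abs_neg, add_mul, one_mul]
      refine add_le_add (h.l1_occupation_le hW) ?_
      rw [mul_comm]
      exact mul_le_mul_of_nonneg_left IsTrajectory.abs_mean_le hf
    -- Subtracting the fixed-point equation of the limit leaves a contracted old error plus the
    -- mixing error of the weight.
    · have e : occupation Pr s a (k + (τ + 1)) (fun x y => W x y * p.followOn x y k (τ + 1)) -
          mean Pr s a W • p.followOnLimit dμ =
          p.γ • ((occupation Pr s a (k + τ) (fun x y => W x y * p.followOn x y k τ) -
            mean Pr s a W • p.followOnLimit dμ) ᵥ* p.chain p.target) +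
          (occupation Pr s a (k + (τ + 1)) W - mean Pr s a W • dμ) := by
        rw [h.occupation_followOn_succ hcov hW]
        conv_lhs => rw [p.followOnLimit_eq dμ]
        rw [sub_vecMul, smul_vecMul]
        module
      rw [e]
      refine (l1_add_le _ _).trans (add_le_add ?_ (hq _))
      rw [l1_smul, abs_of_pos p.γ_pos]
      exact mul_le_mul_of_nonneg_left (l1_vecMul_le (p.chain_mem_rowStochastic _) _) p.γ_pos.le
  have e : occupation Pr s a (k + τ) (fun x y => W x y * p.emphasis x y k τ) -
      mean Pr s a W • p.emphasisLimit dμ =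
      p.lam • (occupation Pr s a (k + τ) W - mean Pr s a W • dμ) + (1 - p.lam) •
        (occupation Pr s a (k + τ) (fun x y => W x y * p.followOn x y k τ) -
          mean Pr s a W • p.followOnLimit dμ) := by
    rw [h.occupation_emphasis hW, emphasisLimit]
    module
  rw [e]
  refine (l1_add_le _ _).trans ?_
  have h1 := p.lam_nonneg
  have h2 := p.lam_le_one
  rw [l1_smul, l1_smul, abs_of_nonneg h1, abs_of_nonneg (by linarith : 0 ≤ 1 - p.lam),
    add_mul C, add_mul]
  refine add_le_add ?_ ?_
  · exact (mul_le_of_le_one_left (l1_nonneg _) h2).trans (hq τ)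
  · exact (mul_le_of_le_one_left (l1_nonneg _) (by linarith)).trans hF

/-- Geometric convergence of the eligibility-weighted occupation. -/
theorem exists_l1_occupation_eligibility_le (hcov : p.Coverage) {dμ : S → ℝ} {C χ ζ : ℝ}
    (hge : GeometricallyErgodic (p.chain p.behavior) dμ C χ) (hχ : χ ≤ ζ) (hγ : p.γ < ζ) :
    ∃ D : ℝ, 0 ≤ D ∧ ∀ {Ω : Type w} [MeasurableSpace Ω] {Pr : Measure Ω} {s : ℕ → Ω → S}
      {a : ℕ → Ω → A}, p.IsTrajectory Pr s a → ∀ (k : ℕ) (W : (ℕ → S) → (ℕ → A) → ℝ),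
      Nonanticipating k W → ∀ (τ : ℕ) (l : Fin d),
      l1 (occupation Pr s a (k + τ) (fun x y => W x y * p.eligibility x y k τ l) -
        mean Pr s a W • fun i => p.weightMatrix (p.emphasisLimit dμ) l i) ≤
          D * ζ ^ τ * mean Pr s a fun x y => |W x y| := by
  obtain ⟨D, hD, hM⟩ := exists_l1_occupation_emphasis_le.{w} hcov hge hχ hγ
  have hζ : 0 < ζ := p.γ_pos.trans hγ
  have hd : 0 < ζ - p.γ := sub_pos.2 hγ
  have hΦ := p.featureBound_nonneg
  set Z : Fin d → S → ℝ := fun l i => p.weightMatrix (p.emphasisLimit dμ) l i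
  have hZ0 : 0 ≤ ∑ l, l1 (Z l) := Finset.sum_nonneg fun l _ => l1_nonneg _
  have hZ : ∀ l, l1 (Z l) ≤ ∑ l, l1 (Z l) := fun l =>
    Finset.single_le_sum (f := fun l => l1 (Z l)) (fun _ _ => l1_nonneg _) (Finset.mem_univ l)
  have hφ : ∀ (v : S → ℝ) (l : Fin d), l1 (fun i => v i * p.φ i l) ≤ p.featureBound * l1 v := by
    intro v l
    unfold l1
    rw [Finset.mul_sum]
    refine Finset.sum_le_sum fun i _ => ?_
    rw [abs_mul, mul_comm]
    exact mul_le_mul_of_nonneg_right (abs_φ_le i l) (abs_nonneg _)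
  refine ⟨(p.featureBound + ∑ l, l1 (Z l)) + (p.featureBound * D) * ζ / (ζ - p.γ), by positivity,
    fun {Ω} _ {Pr s a} h k W hW τ l => ?_⟩
  set V := mean Pr s a fun x y => |W x y|
  have hV : 0 ≤ V := IsTrajectory.mean_nonneg fun _ _ => abs_nonneg _
  refine le_of_geometric_recursion (u := fun τ => l1 (occupation Pr s a (k + τ)
      (fun x y => W x y * p.eligibility x y k τ l) - mean Pr s a W • Z l))
      p.γ_pos.le hγ (by positivity) (by positivity) hV ?_ (fun τ => ?_) τ
  · simp only [eligibility, add_zero]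
    rw [IsTrajectory.occupation_mul_state (K := fun i => p.φ i l), sub_eq_add_neg, ← neg_smul]
    refine (l1_add_le _ _).trans ?_
    rw [l1_smul, abs_neg, add_mul]
    refine add_le_add ((hφ _ l).trans (mul_le_mul_of_nonneg_left (h.l1_occupation_le hW) hΦ)) ?_
    rw [mul_comm]
    exact mul_le_mul (hZ l) IsTrajectory.abs_mean_le (abs_nonneg _) hZ0
  · simp only
    -- The limit solves the same affine recursion, now forced by the emphasis, so the previous lemma
    -- controls the forcing.
    have hZl : Z l = (fun i => p.emphasisLimit dμ i * p.φ i l) +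
        (p.γ * p.lam) • (Z l ᵥ* p.chain p.target) := by
      funext i
      exact p.weightMatrix_apply_eq (p.emphasisLimit dμ) l i
    have e : occupation Pr s a (k + (τ + 1)) (fun x y => W x y * p.eligibility x y k (τ + 1) l) -
        mean Pr s a W • Z l =
        (p.γ * p.lam) • ((occupation Pr s a (k + τ) (fun x y => W x y * p.eligibility x y k τ l) -
          mean Pr s a W • Z l) ᵥ* p.chain p.target) +
        fun i => (occupation Pr s a (k + (τ + 1)) (fun x y => W x y * p.emphasis x y k (τ + 1)) -
          mean Pr s a W • p.emphasisLimit dμ) i * p.φ i l := by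
      rw [h.occupation_eligibility_succ hcov hW]
      conv_lhs => rw [hZl]
      rw [sub_vecMul, smul_vecMul]
      funext i
      simp only [Pi.add_apply, Pi.sub_apply, Pi.smul_apply, smul_eq_mul]
      ring
    rw [e]
    refine (l1_add_le _ _).trans (add_le_add ?_ ?_)
    · rw [l1_smul, abs_of_nonneg p.γlam_nonneg]
      exact mul_le_mul p.γlam_le (l1_vecMul_le (p.chain_mem_rowStochastic _) _)
        (l1_nonneg _) p.γ_pos.le
    · refine (hφ _ l).trans ?_
      have := mul_le_mul_of_nonneg_left (hM h k W hW (τ + 1)) hΦ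
      linarith

theorem isEmphasisLimit_emphasisLimit (hcov : p.Coverage) {dμ : S → ℝ} {C χ : ℝ}
    (hge : GeometricallyErgodic (p.chain p.behavior) dμ C χ) (hpos : ∀ i, 0 < dμ i) :
    IsEmphasisLimit.{w} p dμ (p.emphasisLimit dμ) := by
  intro Ω _ Pr s a h i
  have := h.isProbabilityMeasure
  -- The rate must exceed `γ` strictly, since forcing at the contraction rate itself would produce
  -- an extra factor `τ`.
  obtain ⟨ζ, hζ, hζ1⟩ := exists_between (max_lt p.γ_lt_one hge.2.2.1)
  have hγ : p.γ < ζ := (le_max_left _ _).trans_lt hζ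
  have hχ : χ < ζ := (le_max_right _ _).trans_lt hζ
  have hζ0 : 0 < ζ := p.γ_pos.trans hγ
  obtain ⟨D, hD, hM⟩ := exists_l1_occupation_emphasis_le.{w} hcov hge hχ.le hγ
  have hW : Nonanticipating 0 fun (_ : ℕ → S) (_ : ℕ → A) => (1 : ℝ) := nonanticipating_const 0 1
  have h1 : Tendsto (fun t => occupation Pr s a t (fun x y => p.emphasis x y 0 t) i) atTop
      (𝓝 (p.emphasisLimit dμ i)) := by
    rw [tendsto_iff_dist_tendsto_zero]
    have hz : Tendsto (fun t : ℕ => D * ζ ^ t) atTop (𝓝 0) := by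
      simpa using (tendsto_pow_atTop_nhds_zero_of_lt_one hζ0.le hζ1).const_mul D
    refine squeeze_zero (fun _ => dist_nonneg) (fun t => ?_) hz
    have := hM h 0 _ hW t
    simp only [h.mean_const, zero_add, one_mul, abs_one, mul_one, one_smul] at this
    refine le_trans ?_ this
    rw [Real.dist_eq]
    exact Finset.single_le_sum (f := fun i => |(occupation Pr s a t (fun x y => p.emphasis x y 0 t) -
      p.emphasisLimit dμ) i|) (fun _ _ => abs_nonneg _) (Finset.mem_univ i)
  have h2 : Tendsto (fun t => occupation Pr s a t (fun _ _ => 1) i) atTop (𝓝 (dμ i)) := by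
    rw [tendsto_iff_dist_tendsto_zero]
    have hz : Tendsto (fun t : ℕ => C * χ ^ t) atTop (𝓝 0) := by
      simpa using (tendsto_pow_atTop_nhds_zero_of_lt_one hge.2.1.le hge.2.2.1).const_mul C
    refine squeeze_zero (fun _ => dist_nonneg) (fun t => ?_) hz
    have := h.l1_occupation_sub_le hge hW t
    simp only [h.mean_const, zero_add, abs_one, mul_one, one_smul] at this
    refine le_trans ?_ this
    rw [Real.dist_eq]
    exact Finset.single_le_sum (f := fun i => |(occupation Pr s a t (fun _ _ => 1) - dμ) i|)
      (fun _ _ => abs_nonneg _) (Finset.mem_univ i)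
  have hind : ∀ (t : ℕ) (f : Ω → ℝ), ∫ ω, f ω * (if s t ω = i then 1 else 0) ∂Pr =
      ∫ ω in {ω | s t ω = i}, f ω ∂Pr := fun t f => by
    rw [← integral_indicator (h.measurable_state t i)]
    congr 1
    funext ω
    by_cases hω : s t ω = i <;> simp [Set.indicator, hω]
  have h3 : ∀ t, occupation Pr s a t (fun _ _ => 1) i = Pr.real {ω | s t ω = i} := fun t => by
    unfold occupation mean
    rw [hind t fun _ => 1]
    simp
  -- The conditional mean is `E[M_t 1{s_t = i}] / P(s_t = i)`. The numerator already tends to `m i`,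
  -- and the denominator tends to `d_μ i > 0`, cancelling the prefactor.
  have h4 := (h1.const_mul (dμ i)).div h2 (hpos i).ne'
  rw [mul_div_cancel_left₀ _ (hpos i).ne'] at h4
  refine h4.congr fun t => ?_
  simp only [Pi.div_apply]
  rw [h3, ProbabilityTheory.cond, integral_smul_measure, mul_div_assoc]
  congr 1
  unfold occupation mean
  rw [hind t fun ω => p.emphasis (fun n => s n ω) (fun n => a n ω) 0 t, ENNReal.toReal_inv,
    smul_eq_mul, div_eq_inv_mul]
  rfl

end Problem

end PerETD

/-! ### Second moments of the traces -/

namespace PerETD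

variable {S A : Type*} [Fintype S] [DecidableEq S] [Fintype A] {d : ℕ}
variable {p : Problem S A d} {Ω : Type w} [MeasurableSpace Ω] {Pr : Measure Ω}
  {s : ℕ → Ω → S} {a : ℕ → Ω → A}

/-- Convexity with weights `g` and `1 - g`. Keeping the factor `g < 1` on `u²` lets the moment
inductions close at `ρ_max ^ τ` with no factor of `τ`, even when `ρ_max = 1`. -/
theorem sq_add_le_of_lt_one {g : ℝ} (h0 : 0 ≤ g) (h1 : g < 1) (u z : ℝ) :
    (g * u + z) ^ 2 ≤ g * u ^ 2 + z ^ 2 / (1 - g) := by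
  have h : 0 < 1 - g := by linarith
  have e : g * u ^ 2 + z ^ 2 / (1 - g) - (g * u + z) ^ 2 =
      g / (1 - g) * ((1 - g) * u - z) ^ 2 := by
    field_simp
    ring
  have : 0 ≤ g / (1 - g) * ((1 - g) * u - z) ^ 2 := by positivity
  linarith

theorem abs_dotProduct_le_l1 {v K : S → ℝ} {M : ℝ} (hK : ∀ i, |K i| ≤ M) :
    |v ⬝ᵥ K| ≤ l1 v * M := by
  rw [l1, Finset.sum_mul]
  refine (Finset.abs_sum_le_sum_abs _ _).trans (Finset.sum_le_sum fun i _ => ?_)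
  rw [abs_mul]
  exact mul_le_mul_of_nonneg_left (hK i) (abs_nonneg _)

namespace Problem.IsTrajectory

section SecondMoment

variable (h : p.IsTrajectory Pr s a)

include h

theorem mean_followOn_sq_le [Nonempty S] (hcov : p.Coverage) (k τ : ℕ) :
    mean Pr s a (fun x y => p.followOn x y k τ ^ 2) ≤ p.ratioMax ^ τ / (1 - p.γ) ^ 2 := by
  have hγ0 := p.γ_pos
  have hγ : 0 < 1 - p.γ := by linarith [p.γ_lt_one]
  have hρ := one_le_ratioMax hcov
  induction τ with
  | zero =>
    simp only [followOn, one_pow, pow_zero, h.mean_const]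
    rw [le_div_iff₀ (by positivity), one_mul]
    exact pow_le_one₀ hγ.le (by linarith)
  | succ τ ih =>
    have hF := p.nonanticipating_followOn k τ
    have hF2 : Nonanticipating (k + τ) fun x y => p.followOn x y k τ ^ 2 := hF.comp (· ^ 2)
    have hFρ : Nonanticipating (k + (τ + 1)) fun x y =>
        p.followOn x y k τ ^ 2 * p.ratio (x (k + τ)) (y (k + τ)) ^ 2 :=
      (hF2.mono (by omega)).comp₂
        (nonanticipating_pair (k := k + τ) (by omega) fun i α => p.ratio i α ^ 2) (· * ·)
    calc mean Pr s a (fun x y => p.followOn x y k (τ + 1) ^ 2)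
        ≤ mean Pr s a (fun x y => p.γ * (p.followOn x y k τ ^ 2 *
            p.ratio (x (k + τ)) (y (k + τ)) ^ 2) + 1 / (1 - p.γ)) := by
          refine h.mean_mono ((p.nonanticipating_followOn k (τ + 1)).comp (· ^ 2))
            (hFρ.comp fun z => p.γ * z + 1 / (1 - p.γ)) fun x y => ?_
          have := sq_add_le_of_lt_one hγ0.le p.γ_lt_one
            (p.ratio (x (k + τ)) (y (k + τ)) * p.followOn x y k τ) 1
          rw [followOn, mul_assoc]
          refine this.trans (le_of_eq ?_)
          ring
      _ = p.γ * mean Pr s a (fun x y => p.followOn x y k τ ^ 2 *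
            p.ratio (x (k + τ)) (y (k + τ)) ^ 2) + 1 / (1 - p.γ) := by
          rw [h.mean_add (hFρ.comp (p.γ * ·)) (nonanticipating_const _ _), mean_const_mul,
            h.mean_const]
      _ ≤ p.γ * (p.ratioMax * (p.ratioMax ^ τ / (1 - p.γ) ^ 2)) +
            p.ratioMax ^ (τ + 1) * (1 / (1 - p.γ)) := by
          refine add_le_add (mul_le_mul_of_nonneg_left ?_ hγ0.le)
            (le_mul_of_one_le_left (by positivity) (one_le_pow₀ hρ))
          exact (h.mean_mul_ratio_sq_le hcov hF2 fun _ _ => sq_nonneg _).trans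
            (mul_le_mul_of_nonneg_left ih (by linarith))
      _ = p.ratioMax ^ (τ + 1) / (1 - p.γ) ^ 2 := by
          field_simp
          ring

/-- The same induction as for the follow-on trace, whose second moment is now the forcing; that
accounts for two further powers of `1 / (1 - γ)`. -/
theorem mean_eligibility_sq_le [Nonempty S] (hcov : p.Coverage) (k τ : ℕ) :
    mean Pr s a (fun x y => ‖p.eligibility x y k τ‖ ^ 2) ≤
      p.featureBound ^ 2 / (1 - p.γ) ^ 4 * p.ratioMax ^ τ := by
  have hγ0 := p.γ_pos
  have hγ : 0 < 1 - p.γ := by linarith [p.γ_lt_one]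
  have hρ := one_le_ratioMax hcov
  have hΦ := p.featureBound_nonneg
  induction τ with
  | zero =>
    calc mean Pr s a (fun x y => ‖p.eligibility x y k 0‖ ^ 2)
        ≤ mean Pr s a (fun _ _ => p.featureBound ^ 2) :=
          h.mean_mono ((p.nonanticipating_eligibility k 0).comp fun e => ‖e‖ ^ 2)
            (nonanticipating_const _ _) fun x y =>
            pow_le_pow_left₀ (norm_nonneg _) (norm_φ_le _) 2
      _ ≤ _ := by
          rw [h.mean_const, pow_zero, mul_one, le_div_iff₀ (by positivity)]
          exact mul_le_of_le_one_right (by positivity) (pow_le_one₀ hγ.le (by linarith))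
  | succ τ ih =>
    have he2 : Nonanticipating (k + τ) fun x y => ‖p.eligibility x y k τ‖ ^ 2 :=
      (p.nonanticipating_eligibility k τ).comp fun e => ‖e‖ ^ 2
    have heρ : Nonanticipating (k + (τ + 1)) fun x y =>
        ‖p.eligibility x y k τ‖ ^ 2 * p.ratio (x (k + τ)) (y (k + τ)) ^ 2 :=
      (he2.mono (by omega)).comp₂
        (nonanticipating_pair (k := k + τ) (by omega) fun i α => p.ratio i α ^ 2) (· * ·)
    have hF2 : Nonanticipating (k + (τ + 1)) fun x y => p.followOn x y k (τ + 1) ^ 2 :=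
      (p.nonanticipating_followOn k (τ + 1)).comp (· ^ 2)
    calc mean Pr s a (fun x y => ‖p.eligibility x y k (τ + 1)‖ ^ 2)
        ≤ mean Pr s a (fun x y => p.γ * (‖p.eligibility x y k τ‖ ^ 2 *
            p.ratio (x (k + τ)) (y (k + τ)) ^ 2) +
            p.featureBound ^ 2 / (1 - p.γ) * p.followOn x y k (τ + 1) ^ 2) := by
          refine h.mean_mono ((p.nonanticipating_eligibility k (τ + 1)).comp fun e => ‖e‖ ^ 2)
            ((heρ.comp (p.γ * ·)).comp₂ (hF2.comp (p.featureBound ^ 2 / (1 - p.γ) * ·)) (· + ·))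
            fun x y => ?_
          have hr := p.ratio_nonneg (x (k + τ)) (y (k + τ))
          have hn : ‖p.eligibility x y k (τ + 1)‖ ≤
              p.γ * (p.ratio (x (k + τ)) (y (k + τ)) * ‖p.eligibility x y k τ‖) +
                p.followOn x y k (τ + 1) * p.featureBound := by
            rw [eligibility]
            refine (norm_add_le _ _).trans (add_le_add ?_ ?_)
            · rw [norm_smul, Real.norm_of_nonneg (mul_nonneg p.γlam_nonneg hr), mul_assoc]
              exact mul_le_mul_of_nonneg_right p.γlam_le (mul_nonneg hr (norm_nonneg _))
            · rw [norm_smul, Real.norm_eq_abs]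
              exact mul_le_mul (p.abs_emphasis_le x y k (τ + 1)) (norm_φ_le _) (norm_nonneg _)
                (zero_le_one.trans (p.one_le_followOn x y k (τ + 1)))
          refine (pow_le_pow_left₀ (norm_nonneg _) hn 2).trans
            ((sq_add_le_of_lt_one hγ0.le p.γ_lt_one _ _).trans (le_of_eq ?_))
          ring
      _ = p.γ * mean Pr s a (fun x y => ‖p.eligibility x y k τ‖ ^ 2 *
            p.ratio (x (k + τ)) (y (k + τ)) ^ 2) +
          p.featureBound ^ 2 / (1 - p.γ) *
            mean Pr s a (fun x y => p.followOn x y k (τ + 1) ^ 2) := by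
          rw [h.mean_add (heρ.comp (p.γ * ·))
            (hF2.comp (p.featureBound ^ 2 / (1 - p.γ) * ·)), mean_const_mul, mean_const_mul]
      _ ≤ p.γ * (p.ratioMax * (p.featureBound ^ 2 / (1 - p.γ) ^ 4 * p.ratioMax ^ τ)) +
          p.featureBound ^ 2 / (1 - p.γ) * (p.ratioMax ^ (τ + 1) / (1 - p.γ) ^ 2) := by
          refine add_le_add (mul_le_mul_of_nonneg_left ?_ hγ0.le)
            (mul_le_mul_of_nonneg_left (h.mean_followOn_sq_le hcov k (τ + 1)) (by positivity))
          exact (h.mean_mul_ratio_sq_le hcov he2 fun _ _ => sq_nonneg _).trans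
            (mul_le_mul_of_nonneg_left ih (by linarith))
      _ = p.featureBound ^ 2 / (1 - p.γ) ^ 4 * p.ratioMax ^ (τ + 1) := by
          field_simp
          ring

end SecondMoment

end Problem.IsTrajectory

/-! ### Bias of the expected update -/

namespace Problem

/-- The temporal difference error `r + γ θᵀφ' - θᵀφ`. -/
noncomputable def tdError (p : Problem S A d) (θ : EuclideanSpace ℝ (Fin d)) (i : S) (α : A)
    (j : S) : ℝ :=
  p.reward i α + p.γ * inner ℝ θ (p.φ j) - inner ℝ θ (p.φ i)

theorem abs_tdError_le {θ : EuclideanSpace ℝ (Fin d)} {B : ℝ} (hθ : ‖θ‖ ≤ B) (i : S) (α : A)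
    (j : S) : |p.tdError θ i α j| ≤ p.rewardMax + 2 * (B * p.featureBound) := by
  have hin : ∀ i, |inner ℝ θ (p.φ i)| ≤ B * p.featureBound := fun i =>
    (abs_real_inner_le_norm _ _).trans (mul_le_mul hθ (norm_φ_le i) (norm_nonneg _)
      ((norm_nonneg _).trans hθ))
  have h1 : |p.γ * inner ℝ θ (p.φ j)| ≤ B * p.featureBound := by
    rw [abs_mul, abs_of_pos p.γ_pos]
    exact (mul_le_of_le_one_left (abs_nonneg _) p.γ_lt_one.le).trans (hin j)
  have h2 := abs_reward_le_rewardMax (p := p) i α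
  rw [abs_le] at *
  have h3 := abs_le.1 (hin i)
  unfold tdError
  constructor <;> linarith [h1.1, h1.2, h2.1, h2.2, h3.1, h3.2]

theorem tdError_eq_sum (θ : EuclideanSpace ℝ (Fin d)) (i : S) (α : A) (j : S) :
    p.tdError θ i α j = p.reward i α + ∑ m, θ m * (p.γ * p.φ j m - p.φ i m) := by
  simp only [tdError, PiLp.inner_apply, RCLike.inner_apply, conj_trivial, Finset.mul_sum]
  rw [add_sub_assoc, ← Finset.sum_sub_distrib]
  congr 1
  exact Finset.sum_congr rfl fun m _ => by ring

/-- The features of the temporal difference operator, `(I - γ P_π) Φ`. -/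
noncomputable def bellmanFeature (p : Problem S A d) : Matrix S (Fin d) ℝ :=
  (1 - p.γ • p.chain p.target) * p.featureMatrix

theorem sum_target_mul_reward (p : Problem S A d) (i : S) :
    ∑ α, p.target.prob i α * ∑ j, p.trans i α j * p.reward i α = p.rewardTarget i := by
  refine Finset.sum_congr rfl fun α _ => ?_
  rw [← Finset.sum_mul, p.trans_sum, one_mul, mul_comm]

theorem sum_target_mul_feature (p : Problem S A d) (q : Fin d) (i : S) :
    ∑ α, p.target.prob i α * ∑ j, p.trans i α j * (p.γ * p.φ j q - p.φ i q) =
      -p.bellmanFeature i q := by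
  have e1 : p.bellmanFeature i q =
      p.φ i q - p.γ * ∑ j, p.chain p.target i j * p.φ j q := by
    rw [bellmanFeature, Matrix.sub_mul, Matrix.one_mul, Matrix.smul_mul, Matrix.sub_apply, Matrix.smul_apply,
      smul_eq_mul, Matrix.mul_apply]
    rfl
  have e2 : ∑ j, p.chain p.target i j * p.φ j q =
      ∑ α, p.target.prob i α * ∑ j, p.trans i α j * p.φ j q := by
    simp only [chain, of_apply, Finset.sum_mul, Finset.mul_sum]
    rw [Finset.sum_comm]
    simp only [mul_assoc]
  have e3 : p.φ i q = ∑ α, p.target.prob i α * p.φ i q := by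
    rw [← Finset.sum_mul, p.target.prob_sum, one_mul]
  rw [e1, e2, neg_sub, Finset.mul_sum]
  conv_rhs => rw [e3]
  rw [← Finset.sum_sub_distrib]
  refine Finset.sum_congr rfl fun α _ => ?_
  simp only [mul_sub, Finset.sum_sub_distrib, ← Finset.sum_mul, p.trans_sum, one_mul]
  congr 1
  rw [Finset.mul_sum, Finset.mul_sum, Finset.mul_sum]
  exact Finset.sum_congr rfl fun j _ => by ring

theorem abs_bellmanFeature_le (p : Problem S A d) (q : Fin d) (i : S) :
    |p.bellmanFeature i q| ≤ 2 * p.featureBound := by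
  rw [← abs_neg, ← sum_target_mul_feature]
  calc _ ≤ ∑ α, p.target.prob i α * ∑ j, p.trans i α j * (2 * p.featureBound) := by
        refine (Finset.abs_sum_le_sum_abs _ _).trans (Finset.sum_le_sum fun α _ => ?_)
        rw [abs_mul, abs_of_nonneg (p.target.prob_nonneg i α)]
        refine mul_le_mul_of_nonneg_left ?_ (p.target.prob_nonneg i α)
        refine (Finset.abs_sum_le_sum_abs _ _).trans (Finset.sum_le_sum fun j _ => ?_)
        rw [abs_mul, abs_of_nonneg (p.trans_nonneg i α j)]
        refine mul_le_mul_of_nonneg_left ?_ (p.trans_nonneg i α j)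
        refine (abs_sub _ _).trans ?_
        have h1 := abs_φ_le (p := p) i q
        have h2 := abs_φ_le (p := p) j q
        have h3 : |p.γ * p.φ j q| ≤ |p.φ j q| := by
          rw [abs_mul, abs_of_pos p.γ_pos]
          exact mul_le_of_le_one_left (abs_nonneg _) p.γ_lt_one.le
        linarith
    _ = _ := by simp only [← Finset.sum_mul, p.trans_sum, one_mul, p.target.prob_sum]

/-- The expected update is the negated operator, up to a geometrically small bias. -/
theorem exists_mean_update_le (hcov : p.Coverage) {dμ : S → ℝ} {C χ ζ κ B : ℝ}
    (hge : GeometricallyErgodic (p.chain p.behavior) dμ C χ) (hχ : χ ≤ ζ) (hγ : p.γ < ζ)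
    (hκ : p.IsMonotonicityConst (p.emphasisLimit dμ) κ) (hB : 0 ≤ B) :
    ∃ D : ℝ, 0 ≤ D ∧ ∀ {Ω : Type w} [MeasurableSpace Ω] {Pr : Measure Ω} {s : ℕ → Ω → S}
      {a : ℕ → Ω → A}, p.IsTrajectory Pr s a → ∀ (k : ℕ)
      (θ : (ℕ → S) → (ℕ → A) → EuclideanSpace ℝ (Fin d)), Nonanticipating k θ →
      (∀ x y, ‖θ x y‖ ≤ B) → ∀ τ : ℕ,
      mean Pr s a (fun x y => p.ratio (x (k + τ)) (y (k + τ)) *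
        p.tdError (θ x y) (x (k + τ)) (y (k + τ)) (x (k + τ + 1)) *
          inner ℝ (p.eligibility x y k τ) (θ x y - p.fixedPoint (p.emphasisLimit dμ))) ≤
      -κ * mean Pr s a (fun x y => ‖θ x y - p.fixedPoint (p.emphasisLimit dμ)‖ ^ 2) +
        D * ζ ^ τ * mean Pr s a (fun x y => ‖θ x y - p.fixedPoint (p.emphasisLimit dμ)‖) := by
  obtain ⟨D, hD, hZ⟩ := exists_l1_occupation_eligibility_le.{w} hcov hge hχ hγ
  have hζ : 0 < ζ := p.γ_pos.trans hγ
  have hΦ := p.featureBound_nonneg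
  have hR := p.rewardMax_nonneg
  set m := p.emphasisLimit dμ
  set θs := p.fixedPoint m
  -- Each of the `d` coordinates of the trace contributes one reward term and `d` feature terms.
  refine ⟨d * (D * p.rewardMax + d * (D * B * (2 * p.featureBound))), by positivity,
    fun {Ω} _ {Pr s a} h k θ hθ hθB τ => ?_⟩
  set V := mean Pr s a fun x y => ‖θ x y - θs‖
  set Δ : (ℕ → S) → (ℕ → A) → EuclideanSpace ℝ (Fin d) := fun x y => θ x y - θs
  have hΔ : Nonanticipating k Δ := hθ.comp (· - θs)
  have hΔl : ∀ l, Nonanticipating k fun x y => Δ x y l := fun l => hΔ.comp (· l)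
  have hθΔ : ∀ l m, Nonanticipating k fun x y => θ x y m * Δ x y l := fun l m =>
    hθ.comp₂ hΔ fun u v => u m * v l
  have hn : k ≤ k + τ := Nat.le_add_right k τ
  have hWe : ∀ (W : (ℕ → S) → (ℕ → A) → ℝ) (l : Fin d), Nonanticipating k W →
      Nonanticipating (k + τ) fun x y => W x y * p.eligibility x y k τ l := fun W l hW =>
    (hW.mono hn).comp₂ (p.nonanticipating_eligibility k τ) (· * · l)
  -- The ratio averages `G` over the target policy into a function `K` of the current state; pairing
  -- `K` with the limiting occupation gives the main term.
  have key : ∀ (W : (ℕ → S) → (ℕ → A) → ℝ), Nonanticipating k W → ∀ (l : Fin d)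
      (G : S → A → S → ℝ) (K : S → ℝ) (M : ℝ),
      (∀ i, ∑ α, p.target.prob i α * ∑ j, p.trans i α j * G i α j = K i) → (∀ i, |K i| ≤ M) →
      mean Pr s a (fun x y => W x y * p.eligibility x y k τ l *
        (p.ratio (x (k + τ)) (y (k + τ)) * G (x (k + τ)) (y (k + τ)) (x (k + τ + 1)))) ≤
      mean Pr s a W * ((fun i => p.weightMatrix m l i) ⬝ᵥ K) +
        D * ζ ^ τ * (mean Pr s a fun x y => |W x y|) * M := by
    intro W hW l G K M hGK hKM
    rw [h.mean_mul_ratio_step hcov (hWe W l hW)]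
    simp only [hGK]
    rw [h.mean_mul_state (hWe W l hW)]
    have h1 := abs_dotProduct_le_l1 (v := occupation Pr s a (k + τ)
      (fun x y => W x y * p.eligibility x y k τ l) -
        mean Pr s a W • fun i => p.weightMatrix m l i) hKM
    rw [sub_dotProduct, smul_dotProduct, smul_eq_mul] at h1
    have hM : 0 ≤ M := (abs_nonneg _).trans (hKM h.nonempty_state.some)
    have h2 := mul_le_mul_of_nonneg_right (hZ h k W hW τ l) hM
    linarith [(abs_le.1 (h1.trans h2)).2]
  -- Coordinatewise expansion separates the dependence on the iterate, carried by the weights `Δ_l`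
  -- and `θ_m Δ_l` known at time `k`, from the data of the period.
  have hpt : ∀ x y, p.ratio (x (k + τ)) (y (k + τ)) *
        p.tdError (θ x y) (x (k + τ)) (y (k + τ)) (x (k + τ + 1)) *
          inner ℝ (p.eligibility x y k τ) (Δ x y) =
      ∑ l, (Δ x y l * p.eligibility x y k τ l *
          (p.ratio (x (k + τ)) (y (k + τ)) * p.reward (x (k + τ)) (y (k + τ))) +
        ∑ m, θ x y m * Δ x y l * p.eligibility x y k τ l *
          (p.ratio (x (k + τ)) (y (k + τ)) *
            (p.γ * p.φ (x (k + τ + 1)) m - p.φ (x (k + τ)) m))) := by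
    intro x y
    rw [tdError_eq_sum]
    simp only [PiLp.inner_apply, RCLike.inner_apply, conj_trivial, Finset.mul_sum]
    refine Finset.sum_congr rfl fun l _ => ?_
    rw [mul_add, add_mul, Finset.mul_sum, Finset.sum_mul]
    congr 1
    · ring
    · exact Finset.sum_congr rfl fun m _ => by ring
  have hVl : ∀ l, (mean Pr s a fun x y => |Δ x y l|) ≤ V := fun l =>
    h.mean_mono ((hΔl l).comp abs) (hΔ.comp norm) fun x y => PiLp.norm_apply_le (Δ x y) l
  -- Boundedness of the iterates keeps the bias linear in `‖θ - θ*‖`, so that Young's inequality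
  -- later squares it.
  have hVlq : ∀ l q, (mean Pr s a fun x y => |θ x y q * Δ x y l|) ≤ B * V := fun l q => by
    rw [← IsTrajectory.mean_const_mul]
    refine h.mean_mono ((hθΔ l q).comp abs) ((hΔ.comp norm).comp (B * ·)) fun x y => ?_
    rw [abs_mul]
    exact mul_le_mul ((PiLp.norm_apply_le (θ x y) q).trans (hθB x y))
      (PiLp.norm_apply_le (Δ x y) l) (abs_nonneg _) hB
  have hρ : ∀ (g : S → A → S → ℝ), Nonanticipating (k + τ + 1) fun (x : ℕ → S) (y : ℕ → A) =>
      p.ratio (x (k + τ)) (y (k + τ)) * g (x (k + τ)) (y (k + τ)) (x (k + τ + 1)) :=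
    fun g x x' y y' hx hy => by
      simp only [hx (k + τ) (by omega), hx (k + τ + 1) le_rfl, hy (k + τ) (by omega)]
  have hA0 : ∀ l, Nonanticipating (k + τ + 1) fun x y => Δ x y l * p.eligibility x y k τ l *
      (p.ratio (x (k + τ)) (y (k + τ)) * p.reward (x (k + τ)) (y (k + τ))) := fun l =>
    ((hWe _ l (hΔl l)).mono (by omega)).comp₂ (hρ fun i α _ => p.reward i α) (· * ·)
  have hA1 : ∀ l q, Nonanticipating (k + τ + 1) fun x y =>
      θ x y q * Δ x y l * p.eligibility x y k τ l * (p.ratio (x (k + τ)) (y (k + τ)) *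
            (p.γ * p.φ (x (k + τ + 1)) q - p.φ (x (k + τ)) q)) := fun l q =>
    ((hWe _ l (hθΔ l q)).mono (by omega)).comp₂
      (hρ fun i _ j => p.γ * p.φ j q - p.φ i q) (· * ·)
  have hA1s : ∀ l, Nonanticipating (k + τ + 1) fun x y => ∑ q,
      θ x y q * Δ x y l * p.eligibility x y k τ l * (p.ratio (x (k + τ)) (y (k + τ)) *
            (p.γ * p.φ (x (k + τ + 1)) q - p.φ (x (k + τ)) q)) :=
    fun l x x' y y' hx hy => Finset.sum_congr rfl fun q _ => hA1 l q x x' y y' hx hy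
  have hop : ∀ x y, inner ℝ (p.operator m (θ x y)) (Δ x y) =
      ∑ l, ((∑ q, θ x y q * Δ x y l * ((fun i => p.weightMatrix m l i) ⬝ᵥ
        fun i => p.bellmanFeature i q)) -
        Δ x y l * ((fun i => p.weightMatrix m l i) ⬝ᵥ p.rewardTarget)) := fun x y => by
    simp only [PiLp.inner_apply, RCLike.inner_apply, conj_trivial, operator]
    refine Finset.sum_congr rfl fun l _ => ?_
    rw [Pi.sub_apply, mul_sub]
    congr 1
    rw [keyMatrix, Matrix.mul_assoc, ← bellmanFeature]
    simp only [mulVec, dotProduct, Finset.mul_sum (s := (Finset.univ : Finset (Fin d)))]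
    refine Finset.sum_congr rfl fun q _ => ?_
    rw [Matrix.mul_apply]
    ring
  have hmono : κ * mean Pr s a (fun x y => ‖Δ x y‖ ^ 2) ≤
      ∑ l, ((∑ q, mean Pr s a (fun x y => θ x y q * Δ x y l) *
        ((fun i => p.weightMatrix m l i) ⬝ᵥ
          fun i => p.bellmanFeature i q)) -
        mean Pr s a (fun x y => Δ x y l) *
          ((fun i => p.weightMatrix m l i) ⬝ᵥ p.rewardTarget)) := by
    calc _ = mean Pr s a (fun x y => κ * ‖Δ x y‖ ^ 2) := (IsTrajectory.mean_const_mul κ).symm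
      _ ≤ mean Pr s a (fun x y => inner ℝ (p.operator m (θ x y)) (Δ x y)) :=
          h.mean_mono (hΔ.comp fun v => κ * ‖v‖ ^ 2)
            (hθ.comp₂ hΔ fun u v => inner ℝ (p.operator m u) v) fun x y => hκ.2 (θ x y)
      _ = _ := by
          simp only [hop]
          rw [h.mean_sum (n := k)]
          · refine Finset.sum_congr rfl fun l _ => ?_
            rw [h.mean_sub (n := k), h.mean_sum (n := k), IsTrajectory.mean_mul_const]
            · simp only [IsTrajectory.mean_mul_const]
            · exact fun q => (hθΔ l q).comp (· * _)
            · exact fun x x' y y' hx hy => Finset.sum_congr rfl fun q _ =>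
                (hθΔ l q).comp (· * _) x x' y y' hx hy
            · exact (hΔl l).comp (· * _)
          · intro l x x' y y' hx hy
            simp only [hθ x x' y y' hx hy, hΔ x x' y y' hx hy]
  have hsum : mean Pr s a (fun x y => p.ratio (x (k + τ)) (y (k + τ)) *
        p.tdError (θ x y) (x (k + τ)) (y (k + τ)) (x (k + τ + 1)) *
          inner ℝ (p.eligibility x y k τ) (Δ x y)) =
      ∑ l, (mean Pr s a (fun x y => Δ x y l * p.eligibility x y k τ l *
          (p.ratio (x (k + τ)) (y (k + τ)) * p.reward (x (k + τ)) (y (k + τ)))) +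
        ∑ q, mean Pr s a (fun x y => θ x y q * Δ x y l * p.eligibility x y k τ l *
          (p.ratio (x (k + τ)) (y (k + τ)) *
            (p.γ * p.φ (x (k + τ + 1)) q - p.φ (x (k + τ)) q)))) := by
    simp only [hpt]
    rw [h.mean_sum (n := k + τ + 1)]
    · refine Finset.sum_congr rfl fun l _ => ?_
      rw [h.mean_add (hA0 l) (hA1s l), h.mean_sum (n := k + τ + 1) _ (hA1 l)]
    · exact fun l => (hA0 l).comp₂ (hA1s l) (· + ·)
  have hζτ : 0 ≤ D * ζ ^ τ := by positivity
  have hterm : ∀ l, mean Pr s a (fun x y => Δ x y l * p.eligibility x y k τ l *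
          (p.ratio (x (k + τ)) (y (k + τ)) * p.reward (x (k + τ)) (y (k + τ)))) +
        ∑ q, mean Pr s a (fun x y => θ x y q * Δ x y l * p.eligibility x y k τ l *
          (p.ratio (x (k + τ)) (y (k + τ)) *
            (p.γ * p.φ (x (k + τ + 1)) q - p.φ (x (k + τ)) q))) ≤
      -((∑ q, mean Pr s a (fun x y => θ x y q * Δ x y l) *
        ((fun i => p.weightMatrix m l i) ⬝ᵥ
          fun i => p.bellmanFeature i q)) -
        mean Pr s a (fun x y => Δ x y l) *
          ((fun i => p.weightMatrix m l i) ⬝ᵥ p.rewardTarget)) +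
        (D * p.rewardMax + d * (D * B * (2 * p.featureBound))) * ζ ^ τ * V := by
    intro l
    have h0 := key _ (hΔl l) l (fun i α _ => p.reward i α) p.rewardTarget p.rewardMax
      p.sum_target_mul_reward
      abs_rewardTarget_le
    have h0' := mul_le_mul_of_nonneg_right (mul_le_mul_of_nonneg_left (hVl l) hζτ) hR
    have h1 : ∑ q, mean Pr s a (fun x y => θ x y q * Δ x y l * p.eligibility x y k τ l *
          (p.ratio (x (k + τ)) (y (k + τ)) *
            (p.γ * p.φ (x (k + τ + 1)) q - p.φ (x (k + τ)) q))) ≤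
        ∑ q, (-(mean Pr s a (fun x y => θ x y q * Δ x y l) *
          ((fun i => p.weightMatrix m l i) ⬝ᵥ
            fun i => p.bellmanFeature i q)) +
          D * ζ ^ τ * (B * V) * (2 * p.featureBound)) := by
      refine Finset.sum_le_sum fun q _ => ?_
      have h2 := key _ (hθΔ l q) l (fun i _ j => p.γ * p.φ j q - p.φ i q)
        (fun i => -p.bellmanFeature i q)
        (2 * p.featureBound) (p.sum_target_mul_feature q)
        fun i => by rw [abs_neg]; exact p.abs_bellmanFeature_le q i
      have h3 := mul_le_mul_of_nonneg_right (mul_le_mul_of_nonneg_left (hVlq l q) hζτ)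
        (by positivity : 0 ≤ 2 * p.featureBound)
      have h4 : ((fun i => p.weightMatrix m l i) ⬝ᵥ
          fun i => -p.bellmanFeature i q) =
          -((fun i => p.weightMatrix m l i) ⬝ᵥ
            fun i => p.bellmanFeature i q) := by
        simp [dotProduct]
      rw [h4] at h2
      linarith
    rw [Finset.sum_add_distrib, Finset.sum_neg_distrib] at h1
    simp only [Finset.sum_const, Finset.card_univ, Fintype.card_fin, nsmul_eq_mul] at h1
    linarith
  rw [hsum]
  refine (Finset.sum_le_sum fun l _ => hterm l).trans ?_
  rw [Finset.sum_add_distrib, Finset.sum_neg_distrib]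
  simp only [Finset.sum_const, Finset.card_univ, Fintype.card_fin, nsmul_eq_mul]
  linarith

end Problem

end PerETD

/-! ### One step of the projected iteration -/

namespace PerETD

variable {S A : Type*} [Fintype S] [DecidableEq S] [Fintype A] {d : ℕ}
variable {p : Problem S A d} {Ω : Type w} [MeasurableSpace Ω] {Pr : Measure Ω}
  {s : ℕ → Ω → S} {a : ℕ → Ω → A}

namespace Problem

theorem norm_projBall_sub_le {B : ℝ} {z : EuclideanSpace ℝ (Fin d)} (hz : ‖z‖ ≤ B)
    (θ : EuclideanSpace ℝ (Fin d)) : ‖projBall B θ - z‖ ≤ ‖θ - z‖ := by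
  unfold projBall
  split_ifs with h
  · exact le_rfl
  · have hB : 0 ≤ B := (norm_nonneg z).trans hz
    have h1 : B < ‖θ‖ := not_le.mp h
    have h0 : 0 < ‖θ‖ := hB.trans_lt h1
    set c := B / ‖θ‖
    have hc : c * ‖θ‖ = B := div_mul_cancel₀ _ h0.ne'
    have hc1 : c ≤ 1 := (div_le_one h0).2 h1.le
    refine le_of_sq_le_sq ?_ (norm_nonneg _)
    rw [norm_sub_sq_real, norm_sub_sq_real, norm_smul, Real.norm_of_nonneg (by positivity : 0 ≤ c),
      real_inner_smul_left]
    -- By this bound the difference of the squared distances is at least `(1 - c)² ‖θ‖² ≥ 0`.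
    have h2 : inner ℝ θ z ≤ ‖θ‖ * (c * ‖θ‖) := by
      rw [hc]
      exact (real_inner_le_norm θ z).trans (mul_le_mul_of_nonneg_left hz h0.le)
    have h3 := mul_le_mul_of_nonneg_left h2 (by linarith : 0 ≤ 1 - c)
    nlinarith [mul_nonneg (sq_nonneg (1 - c)) (sq_nonneg ‖θ‖)]

theorem norm_iterate_le {b : ℕ} {η : ℕ → ℝ} {B : ℝ} (hB : 0 ≤ B) (x : ℕ → S) (y : ℕ → A)
    (t : ℕ) : ‖p.iterate b η B x y t‖ ≤ B := by
  cases t with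
  | zero => simpa [iterate] using hB
  | succ t => exact (projBall_spec hB _).1

/-- Iteration `t` reads the state at time `(t + 1)(b + 1)`, the first of the next period, but not
the action taken there; nonanticipation is defined with exactly this asymmetry. -/
theorem nonanticipating_iterate (p : Problem S A d) (b : ℕ) (η : ℕ → ℝ) (B : ℝ) (t : ℕ) :
    Nonanticipating (t * (b + 1)) fun x y => p.iterate b η B x y t := by
  induction t with
  | zero => exact nonanticipating_const _ _
  | succ t ih =>
    intro x x' y y' hx hy
    have hle : (t + 1) * (b + 1) = t * (b + 1) + b + 1 := by ring
    rw [hle] at hx hy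
    have e1 := ih x x' y y' (fun k hk => hx k (by omega)) fun k hk => hy k (by omega)
    have e2 := p.nonanticipating_eligibility (t * (b + 1)) b x x' y y'
      (fun k hk => hx k (by omega)) fun k hk => hy k (by omega)
    simp only at e1 e2
    simp only [iterate, e1, e2, hx (t * (b + 1) + b) (by omega), hx (t * (b + 1) + b + 1) le_rfl,
      hy (t * (b + 1) + b) (by omega)]

open scoped Matrix.Norms.L2Operator in
theorem radius_nonneg {κ : ℝ} (hκ : 0 < κ) : 0 ≤ p.radius κ := by
  have := p.rewardMax_nonneg
  have : 0 < 1 - p.γ := by linarith [p.γ_lt_one]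
  unfold radius
  exact div_nonneg (mul_nonneg (norm_nonneg _) (by assumption)) (by positivity)

theorem iterate_succ_eq (b : ℕ) (η : ℕ → ℝ) (B : ℝ) (x : ℕ → S) (y : ℕ → A) (t : ℕ) :
    p.iterate b η B x y (t + 1) = projBall B (p.iterate b η B x y t +
      (η t * (p.ratio (x (t * (b + 1) + b)) (y (t * (b + 1) + b)) *
        p.tdError (p.iterate b η B x y t) (x (t * (b + 1) + b)) (y (t * (b + 1) + b))
          (x (t * (b + 1) + b + 1)))) • p.eligibility x y (t * (b + 1)) b) := rfl

/-- One step of the iteration, along a path. -/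
theorem norm_iterate_succ_sub_sq_le {b : ℕ} {η : ℕ → ℝ} {B : ℝ} {z : EuclideanSpace ℝ (Fin d)}
    (hz : ‖z‖ ≤ B) (x : ℕ → S) (y : ℕ → A) (t : ℕ) :
    ‖p.iterate b η B x y (t + 1) - z‖ ^ 2 ≤ ‖p.iterate b η B x y t - z‖ ^ 2 +
      2 * η t * (p.ratio (x (t * (b + 1) + b)) (y (t * (b + 1) + b)) *
        p.tdError (p.iterate b η B x y t) (x (t * (b + 1) + b)) (y (t * (b + 1) + b))
          (x (t * (b + 1) + b + 1)) *
        inner ℝ (p.eligibility x y (t * (b + 1)) b) (p.iterate b η B x y t - z)) +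
      η t ^ 2 * ((p.rewardMax + 2 * (B * p.featureBound)) ^ 2 *
        (‖p.eligibility x y (t * (b + 1)) b‖ ^ 2 *
          p.ratio (x (t * (b + 1) + b)) (y (t * (b + 1) + b)) ^ 2)) := by
  have hB : 0 ≤ B := (norm_nonneg z).trans hz
  rw [iterate_succ_eq]
  set θ := p.iterate b η B x y t
  set ρ := p.ratio (x (t * (b + 1) + b)) (y (t * (b + 1) + b))
  set e := p.eligibility x y (t * (b + 1)) b
  set δ := p.tdError θ (x (t * (b + 1) + b)) (y (t * (b + 1) + b)) (x (t * (b + 1) + b + 1))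
  have hδ : δ ^ 2 ≤ (p.rewardMax + 2 * (B * p.featureBound)) ^ 2 :=
    sq_le_sq' (abs_le.1 (abs_tdError_le (norm_iterate_le hB x y t) _ _ _)).1
      (abs_le.1 (abs_tdError_le (norm_iterate_le hB x y t) _ _ _)).2
  refine (pow_le_pow_left₀ (norm_nonneg _) (norm_projBall_sub_le hz _) 2).trans ?_
  rw [add_sub_right_comm, norm_add_sq_real, norm_smul, real_inner_smul_right, mul_pow,
    Real.norm_eq_abs, sq_abs, real_inner_comm]
  have h1 : 0 ≤ η t ^ 2 * (‖e‖ ^ 2 * ρ ^ 2) := by positivity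
  have h2 := mul_le_mul_of_nonneg_left hδ h1
  nlinarith

end Problem

/-! ### The mean square error recursion -/

/-- The recursion of projected stochastic approximation with stepsizes of order `1 / (t + s₀)`. -/
theorem le_add_div_of_recursion {u : ℕ → ℝ} {s₀ β V : ℝ} (hs₀ : 2 ≤ s₀) (hβ : 0 ≤ β)
    (hV : 0 ≤ V) (h0 : 0 ≤ u 0)
    (hu : ∀ t : ℕ, u (t + 1) ≤ (1 - 2 / (t + s₀)) * u t + 2 / (t + s₀) * β + V / (t + s₀) ^ 2)
    (t : ℕ) : u t ≤ β + (V + u 0 * s₀) / (t + s₀) := by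
  induction t with
  | zero =>
    have : u 0 ≤ (V + u 0 * s₀) / s₀ := by
      rw [le_div_iff₀ (by linarith)]
      linarith
    simpa using this.trans (le_add_of_nonneg_left hβ)
  | succ t ih =>
    set W := V + u 0 * s₀
    have hW : V ≤ W := le_add_of_nonneg_right (by positivity)
    push_cast
    set r : ℝ := t + s₀
    have hr : 2 ≤ r := by
      have : (0 : ℝ) ≤ t := Nat.cast_nonneg t
      linarith
    have hr0 : 0 < r := by linarith
    have h1 : 0 ≤ 1 - 2 / r := by
      rw [sub_nonneg, div_le_one hr0]
      exact hr
    refine (hu t).trans ?_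
    have h2 := mul_le_mul_of_nonneg_left ih h1
    have h3 : W / r - 2 * W / r ^ 2 + V / r ^ 2 ≤ W / (r + 1) := by
      have hW0 : 0 ≤ W := hV.trans hW
      -- The drift removes `2W/r²`, the noise returns at most `W/r²`, and the net loss `W/r²`
      -- exceeds the decrease of `W/r` to `W/(r + 1)`.
      have e : W / (r + 1) - (W / r - 2 * W / r ^ 2 + W / r ^ 2) = W / (r ^ 2 * (r + 1)) := by
        field_simp
        ring
      have h4 : V / r ^ 2 ≤ W / r ^ 2 := by gcongr
      have h5 : 0 ≤ W / (r ^ 2 * (r + 1)) := by positivity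
      linarith
    have e2 : (1 - 2 / r) * (β + W / r) + 2 / r * β = β + (W / r - 2 * W / r ^ 2) := by
      field_simp
      ring
    have e3 : (t : ℝ) + 1 + s₀ = r + 1 := by simp only [r]; ring
    rw [e3]
    linarith

namespace Problem

/-- The mean square error is bounded by the squared bias plus the variance over the horizon. -/
theorem exists_meanSquareErrorLE [Nonempty S] (hcov : p.Coverage) {dμ : S → ℝ} {C χ κ L : ℝ}
    (hst : IsStationary (p.chain p.behavior) dμ)
    (hu : IsUnit (p.keyMatrix (p.emphasisLimit dμ)).det)
    (hge : GeometricallyErgodic (p.chain p.behavior) dμ C χ)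
    (hκ : p.IsMonotonicityConst (p.emphasisLimit dμ) κ)
    (hL : p.IsLipschitzConst (p.emphasisLimit dμ) L) :
    ∃ C₁ : ℝ, 0 ≤ C₁ ∧ ∀ b T : ℕ, 1 ≤ T →
      MeanSquareErrorLE.{w} p (p.emphasisLimit dμ) κ L b T
        (C₁ * (max p.γ χ ^ b + p.ratioMax ^ b / T)) := by
  set ξ := max p.γ χ with hξ
  have hξ0 : 0 < ξ := p.γ_pos.trans_le (le_max_left _ _)
  have hξ1 : ξ < 1 := max_lt p.γ_lt_one hge.2.2.1
  -- Only the squared bias matters and only order `ξ ^ b` is needed, so the bias may decay at rate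
  -- `√ξ`. This leaves strict room above `γ`.
  have hζ : ξ < √ξ := by
    rw [Real.lt_sqrt hξ0.le]
    nlinarith
  have hB := p.radius_nonneg hκ.1
  have hz := p.norm_fixedPoint_le dμ hst.1 hst.2.1 hκ
  set m := p.emphasisLimit dμ
  set B := p.radius κ
  set z := p.fixedPoint m
  obtain ⟨D, hD, hbias⟩ := exists_mean_update_le.{w} hcov hge ((le_max_right _ _).trans hζ.le)
    ((le_max_left _ _).trans_lt hζ) hκ hB
  have hκ0 := hκ.1
  have hL0 := hL.1
  have hρ := one_le_ratioMax hcov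
  have hγ1 : 0 < 1 - p.γ := by linarith [p.γ_lt_one]
  set E := p.featureBound ^ 2 / (1 - p.γ) ^ 4
  have hE : 0 ≤ E := by positivity
  set δ := p.rewardMax + 2 * (B * p.featureBound)
  set s₀ := 8 * L ^ 2 / κ ^ 2
  have hs₀0 : 0 < s₀ := by positivity
  set V₀ := 4 / κ ^ 2 * (δ ^ 2 * (p.ratioMax * E))
  have hV₀ : 0 ≤ V₀ := by positivity
  refine ⟨D ^ 2 / κ ^ 2 + (V₀ + B ^ 2 * s₀), by positivity,
    fun b T hT Ω _ Pr s a h => ?_⟩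
  set θ : ℕ → (ℕ → S) → (ℕ → A) → EuclideanSpace ℝ (Fin d) :=
    fun t x y => p.iterate b (stepsize κ L) B x y t
  have hθ : ∀ t, Nonanticipating (t * (b + 1)) (θ t) := p.nonanticipating_iterate b _ B
  have hsq : ∀ t, Nonanticipating (t * (b + 1)) fun x y => ‖θ t x y - z‖ ^ 2 := fun t =>
    (hθ t).comp fun v => ‖v - z‖ ^ 2
  refine ⟨h.integrable (hsq T), ?_⟩
  have hT0 : (1 : ℝ) ≤ T := by exact_mod_cast hT
  have hρb : 1 ≤ p.ratioMax ^ b := one_le_pow₀ hρ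
  -- In dimension zero the error vanishes; positive dimension is needed for `κ ≤ L`, hence for `s₀ ≥
  -- 8`.
  rcases Nat.eq_zero_or_pos d with rfl | hd
  · simp only [Subsingleton.elim _ (0 : EuclideanSpace ℝ (Fin 0)), norm_zero, ne_eq,
      OfNat.ofNat_ne_zero, not_false_eq_true, zero_pow, integral_zero]
    positivity
  have : NeZero d := ⟨hd.ne'⟩
  have hs₀ : 2 ≤ s₀ := by
    have := monotonicityConst_le_lipschitzConst hu hκ hL
    rw [le_div_iff₀ (by positivity)]
    nlinarith
  set u : ℕ → ℝ := fun t => mean Pr s a fun x y => ‖θ t x y - z‖ ^ 2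
  have hrec : ∀ t : ℕ, u (t + 1) ≤ (1 - 2 / (t + s₀)) * u t +
      2 / (t + s₀) * (D ^ 2 / κ ^ 2 * ξ ^ b) + V₀ * p.ratioMax ^ b / (t + s₀) ^ 2 := by
    intro t
    set k := t * (b + 1)
    have hr : 0 < (t : ℝ) + s₀ := by positivity
    have hη : stepsize κ L t = 2 / (κ * (t + s₀)) := rfl
    have hη0 : 0 ≤ stepsize κ L t := by rw [hη]; positivity
    have hk : k ≤ k + b + 1 := by omega
    have hU : Nonanticipating (k + b + 1) fun x y =>
        p.ratio (x (k + b)) (y (k + b)) *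
          p.tdError (θ t x y) (x (k + b)) (y (k + b)) (x (k + b + 1)) *
          inner ℝ (p.eligibility x y k b) (θ t x y - z) := fun x x' y y' hx hy => by
      have e1 := (hθ t).mono hk x x' y y' hx hy
      have e2 := (p.nonanticipating_eligibility k b).mono (by omega) x x' y y' hx hy
      simp only at e2
      simp only [e1, e2, hx (k + b) (by omega), hx (k + b + 1) le_rfl, hy (k + b) (by omega)]
    have he2 : Nonanticipating (k + b) fun x y => ‖p.eligibility x y k b‖ ^ 2 :=
      (p.nonanticipating_eligibility k b).comp fun e => ‖e‖ ^ 2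
    have heρ : Nonanticipating (k + b + 1) fun x y =>
        ‖p.eligibility x y k b‖ ^ 2 * p.ratio (x (k + b)) (y (k + b)) ^ 2 :=
      (he2.mono (by omega)).comp₂
        (nonanticipating_pair (k := k + b) (by omega) fun i α => p.ratio i α ^ 2) (· * ·)
    have h1 : u (t + 1) ≤ u t + 2 * stepsize κ L t * mean Pr s a (fun x y =>
        p.ratio (x (k + b)) (y (k + b)) *
          p.tdError (θ t x y) (x (k + b)) (y (k + b)) (x (k + b + 1)) *
          inner ℝ (p.eligibility x y k b) (θ t x y - z)) +
        stepsize κ L t ^ 2 * (δ ^ 2 * mean Pr s a (fun x y =>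
          ‖p.eligibility x y k b‖ ^ 2 * p.ratio (x (k + b)) (y (k + b)) ^ 2)) := by
      have hn : (t + 1) * (b + 1) = k + b + 1 := by simp only [k]; ring
      have hs1 := hsq (t + 1)
      rw [hn] at hs1
      have hUc := hU.comp (2 * stepsize κ L t * ·)
      have hec := heρ.comp fun v => stepsize κ L t ^ 2 * (δ ^ 2 * v)
      rw [← IsTrajectory.mean_const_mul, ← IsTrajectory.mean_const_mul,
        ← IsTrajectory.mean_const_mul, ← h.mean_add ((hsq t).mono hk) hUc,
        ← h.mean_add (((hsq t).mono hk).comp₂ hUc (· + ·)) hec]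
      exact h.mean_mono hs1 ((((hsq t).mono hk).comp₂ hUc (· + ·)).comp₂ hec (· + ·))
        fun x y => norm_iterate_succ_sub_sq_le hz x y t
    have h2 := hbias h k (θ t) (hθ t) (fun x y => norm_iterate_le hB x y t) b
    have h3 : mean Pr s a (fun x y =>
        ‖p.eligibility x y k b‖ ^ 2 * p.ratio (x (k + b)) (y (k + b)) ^ 2) ≤
        p.ratioMax * (E * p.ratioMax ^ b) :=
      (h.mean_mul_ratio_sq_le hcov he2 fun _ _ => sq_nonneg _).trans
        (mul_le_mul_of_nonneg_left (h.mean_eligibility_sq_le hcov k b) (by linarith))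
    -- Young's inequality spends half of the drift `κ`; with `η_t = 2/(κ(t + s₀))` the remaining
    -- half gives the factor `1 - 2/(t + s₀)`.
    have h4 : D * √ξ ^ b * (mean Pr s a fun x y => ‖θ t x y - z‖) ≤
        κ / 2 * u t + D ^ 2 * ξ ^ b / (2 * κ) := by
      have e : D ^ 2 * ξ ^ b = (D * √ξ ^ b) ^ 2 := by
        rw [mul_pow, ← pow_mul, mul_comm b, pow_mul, Real.sq_sqrt hξ0.le]
      have hn1 : Nonanticipating k fun x y => ‖θ t x y - z‖ := (hθ t).comp fun v => ‖v - z‖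
      rw [e, ← IsTrajectory.mean_const_mul, ← IsTrajectory.mean_const_mul,
        ← h.mean_const ((D * √ξ ^ b) ^ 2 / (2 * κ)),
        ← h.mean_add ((hsq t).comp (κ / 2 * ·)) (nonanticipating_const _ _)]
      refine h.mean_mono (hn1.comp (D * √ξ ^ b * ·))
        (((hsq t).comp (κ / 2 * ·)).comp (· + (D * √ξ ^ b) ^ 2 / (2 * κ))) fun x y => ?_
      set v := ‖θ t x y - z‖
      set c := D * √ξ ^ b
      have e2 : κ / 2 * v ^ 2 + c ^ 2 / (2 * κ) - c * v = (κ * v - c) ^ 2 / (2 * κ) := by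
        field_simp
        ring
      have : 0 ≤ (κ * v - c) ^ 2 / (2 * κ) := by positivity
      linarith
    have h5 := mul_le_mul_of_nonneg_left (h2.trans (add_le_add le_rfl h4))
      (by positivity : 0 ≤ 2 * stepsize κ L t)
    have h6 := mul_le_mul_of_nonneg_left (mul_le_mul_of_nonneg_left h3 (sq_nonneg δ))
      (sq_nonneg (stepsize κ L t))
    refine h1.trans ((add_le_add (add_le_add le_rfl h5) h6).trans (le_of_eq ?_))
    rw [hη]
    simp only [V₀]
    change u t + 2 * (2 / (κ * (t + s₀))) * (-κ * u t + _) + _ = _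
    field_simp
    ring
  have hu0 : u 0 ≤ B ^ 2 := by
    have : u 0 = ‖z‖ ^ 2 := by
      simp only [u, θ, iterate, zero_sub, norm_neg]
      exact h.mean_const _
    rw [this]
    exact pow_le_pow_left₀ (norm_nonneg _) hz 2
  have hu00 : 0 ≤ u 0 := IsTrajectory.mean_nonneg fun _ _ => sq_nonneg _
  have hmain := le_add_div_of_recursion hs₀ (by positivity) (by positivity) hu00 hrec T
  refine hmain.trans ?_
  -- The initial error is merged into the variance term, using `ρ_max ^ b ≥ 1`.
  have e1 : (V₀ * p.ratioMax ^ b + u 0 * s₀) / (T + s₀) ≤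
      (V₀ + B ^ 2 * s₀) * (p.ratioMax ^ b / T) := by
    have hT1 : (0 : ℝ) < T := by linarith
    have h1 : u 0 * s₀ ≤ B ^ 2 * s₀ * p.ratioMax ^ b :=
      (mul_le_mul_of_nonneg_right hu0 hs₀0.le).trans (le_mul_of_one_le_right (by positivity) hρb)
    calc (V₀ * p.ratioMax ^ b + u 0 * s₀) / (T + s₀)
        ≤ (V₀ * p.ratioMax ^ b + u 0 * s₀) / T :=
          div_le_div_of_nonneg_left (by positivity) hT1 (by linarith)
      _ ≤ (V₀ + B ^ 2 * s₀) * p.ratioMax ^ b / T :=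
          div_le_div_of_nonneg_right (by linarith) hT1.le
      _ = _ := mul_div_assoc _ _ _
  have e2 : 0 ≤ D ^ 2 / κ ^ 2 * (p.ratioMax ^ b / T) := by positivity
  have e3 : 0 ≤ (V₀ + B ^ 2 * s₀) * ξ ^ b := by positivity
  linarith

end Problem

end PerETD

/-! ### Choice of the period length and sample complexity -/

namespace PerETD

/-- With logarithmic period length, squared bias and variance are both of order `T ^ (-α)`. -/
theorem pow_add_pow_div_le {ξ ρ α K : ℝ} (hξ0 : 0 < ξ) (hξ1 : ξ < 1) (hρ : 1 ≤ ρ)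
    (hα : α = 1 / (Real.logb (1 / ξ) ρ + 1)) {b T : ℕ} (hT : 1 ≤ T)
    (hb : |(b : ℝ) - Real.log T / (Real.log ρ + Real.log (1 / ξ))| ≤ K) :
    ξ ^ b + ρ ^ b / T ≤
      (Real.exp (Real.log (1 / ξ) * K) + Real.exp (Real.log ρ * K)) / (T : ℝ) ^ α := by
  have hT0 : (0 : ℝ) < T := by exact_mod_cast hT
  have hρ0 : 0 < ρ := by linarith
  have hx : 0 < Real.log (1 / ξ) := Real.log_pos ((one_lt_div hξ0).2 hξ1)
  have hr : 0 ≤ Real.log ρ := Real.log_nonneg hρ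
  have hξe : ξ = Real.exp (-Real.log (1 / ξ)) := by
    rw [one_div, Real.log_inv, neg_neg, Real.exp_log hξ0]
  have hρe : ρ = Real.exp (Real.log ρ) := (Real.exp_log hρ0).symm
  have hTe : (T : ℝ) = Real.exp (Real.log T) := (Real.exp_log hT0).symm
  have hα' : α * (Real.log ρ + Real.log (1 / ξ)) = Real.log (1 / ξ) := by
    rw [hα, Real.logb]
    field_simp
  set lx := Real.log (1 / ξ)
  set lr := Real.log ρ
  set t := Real.log T
  have hl : 0 < lr + lx := by linarith
  -- The unrounded period length, at which `ξ ^ q = ρ ^ q / T = T ^ (-α)`. Replacing `q` by `b`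
  -- costs at most the factors `exp (lx K)` and `exp (lr K)`.
  obtain ⟨q, hq⟩ : ∃ q, q = t / (lr + lx) := ⟨_, rfl⟩
  have ht : t = q * (lr + lx) := by rw [hq, div_mul_cancel₀ _ hl.ne']
  rw [← hq] at hb
  have hb' := abs_le.1 hb
  have hTα : (T : ℝ) ^ α = Real.exp (q * lx) := by
    rw [Real.rpow_def_of_pos hT0]
    congr 1
    change t * α = q * lx
    rw [ht]
    linear_combination q * hα'
  rw [hTα, add_div, ← Real.exp_sub, ← Real.exp_sub]
  refine add_le_add ?_ ?_
  · rw [hξe, ← Real.exp_nat_mul, Real.exp_le_exp]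
    nlinarith
  · rw [hρe, hTe, ← Real.exp_nat_mul, ← Real.exp_sub, Real.exp_le_exp]
    rw [ht]
    nlinarith

/-- The number of samples needed for accuracy `ε`. -/
theorem exists_sample_complexity {C₀ α l : ℝ} (hC₀ : 0 ≤ C₀) (hα : 0 < α) (hl : 0 < l) (K : ℝ) :
    ∃ C : ℝ, ∀ ε : ℝ, 0 < ε → ε ≤ 1 → ∃ T : ℕ, 1 ≤ T ∧ C₀ / (T : ℝ) ^ α ≤ ε ∧
      ∀ b : ℝ, |b - Real.log T / l| ≤ K →
        (T : ℝ) * (b + 1) ≤ C * (1 / ε) ^ (1 / α) * (1 + Real.log (1 / ε)) := by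
  -- Makes the constant at least one, so that `X`, the solution of `C' / X ^ α = ε`, is at least one
  -- and rounding it up at most doubles it.
  set C' := C₀ + 1
  have hC' : 1 ≤ C' := by simp only [C']; linarith
  have hC'0 : 0 < C' := by linarith
  have hlogC := Real.log_nonneg hC'
  have hlog2 : 0 ≤ Real.log 2 := Real.log_nonneg (by norm_num)
  set c := (Real.log 2 + 1 / α * Real.log C') / l + |K| + 1 + 1 / (α * l)
  have hc : 0 ≤ c := by positivity
  refine ⟨2 * C' ^ (1 / α) * c, fun ε hε hε1 => ?_⟩
  have h1ε : 1 ≤ 1 / ε := (one_le_div hε).2 hε1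
  have hlogε : 0 ≤ Real.log (1 / ε) := Real.log_nonneg h1ε
  set X := (C' * (1 / ε)) ^ (1 / α)
  have hX : 1 ≤ X := Real.one_le_rpow (by nlinarith) (by positivity)
  have hXα : X ^ α = C' * (1 / ε) := by
    rw [← Real.rpow_mul (by positivity), one_div_mul_cancel hα.ne', Real.rpow_one]
  have hXlog : Real.log X = 1 / α * (Real.log C' + Real.log (1 / ε)) := by
    rw [Real.log_rpow (by positivity), Real.log_mul hC'0.ne' (by positivity)]
  have hceil := Nat.le_ceil X
  have hceil' : (⌈X⌉₊ : ℝ) ≤ 2 * X := by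
    have := Nat.ceil_lt_add_one (by linarith : 0 ≤ X)
    linarith
  have hT0 : (0 : ℝ) < ⌈X⌉₊ := by linarith
  refine ⟨⌈X⌉₊, Nat.one_le_ceil_iff.2 (by linarith), ?_, fun b hb => ?_⟩
  · rw [div_le_iff₀ (by positivity)]
    have h1 : C' * (1 / ε) ≤ (⌈X⌉₊ : ℝ) ^ α := by
      rw [← hXα]
      exact Real.rpow_le_rpow (by linarith) hceil hα.le
    calc C₀ ≤ ε * (C' * (1 / ε)) := by
          field_simp
          simp only [C']
          linarith
      _ ≤ _ := mul_le_mul_of_nonneg_left h1 hε.le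
  · have hlogT : Real.log ⌈X⌉₊ ≤ Real.log 2 + 1 / α * (Real.log C' + Real.log (1 / ε)) := by
      rw [← hXlog, ← Real.log_mul (by norm_num) (by linarith)]
      exact Real.log_le_log hT0 hceil'
    have hb1 : b + 1 ≤ c * (1 + Real.log (1 / ε)) := by
      have h1 := (abs_le.1 hb).2
      have h2 := div_le_div_of_nonneg_right hlogT hl.le
      have h3 : (Real.log 2 + 1 / α * (Real.log C' + Real.log (1 / ε))) / l =
          (Real.log 2 + 1 / α * Real.log C') / l + 1 / (α * l) * Real.log (1 / ε) := by
        field_simp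
        ring
      have h4 : 0 ≤ (Real.log 2 + 1 / α * Real.log C') / l + |K| + 1 := by positivity
      have h5 : 0 ≤ 1 / (α * l) := by positivity
      have h6 := mul_nonneg h4 hlogε
      have h7 := le_abs_self K
      have h8 : c * (1 + Real.log (1 / ε)) =
          ((Real.log 2 + 1 / α * Real.log C') / l + |K| + 1) +
          ((Real.log 2 + 1 / α * Real.log C') / l + |K| + 1) * Real.log (1 / ε) +
          1 / (α * l) + 1 / (α * l) * Real.log (1 / ε) := by
        simp only [c]
        ring
      linarith
    have hX' : X = C' ^ (1 / α) * (1 / ε) ^ (1 / α) :=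
      Real.mul_rpow (by positivity) (by positivity)
    calc (⌈X⌉₊ : ℝ) * (b + 1) ≤ (⌈X⌉₊ : ℝ) * (c * (1 + Real.log (1 / ε))) :=
          mul_le_mul_of_nonneg_left hb1 hT0.le
      _ ≤ 2 * X * (c * (1 + Real.log (1 / ε))) :=
          mul_le_mul_of_nonneg_right hceil' (by positivity)
      _ = _ := by rw [hX']; ring

variable {S A : Type*} [Fintype S] [DecidableEq S] [Fintype A] {d : ℕ}

theorem Problem.MeanSquareErrorLE.mono {p : Problem S A d} {m : S → ℝ} {κ L c c' : ℝ} {b T : ℕ}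
    (h : Problem.MeanSquareErrorLE.{w} p m κ L b T c) (hc : c ≤ c') :
    Problem.MeanSquareErrorLE.{w} p m κ L b T c' := fun Ω _ Pr s a ht =>
  ⟨(h Ω Pr s a ht).1, (h Ω Pr s a ht).2.trans hc⟩

end PerETD

/-! ### The convergence theorem -/

open PerETD PerETD.Problem in
theorem theorem2 {S A : Type*} [Fintype S] [DecidableEq S] [Nonempty S] [Fintype A] {d : ℕ}
    (p : Problem S A d)
    (hφ : LinearIndependent ℝ (fun j : Fin d => fun s : S => p.φ s j))
    (hcov : p.Coverage)
    (hirr : (p.chain p.behavior).IsIrreducible)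
    (haper : Aperiodic (p.chain p.behavior)) :
    ∃ dμ m : S → ℝ,
      -- `dμ` is the unique stationary distribution, and the chain is geometrically ergodic
      (IsStationary (p.chain p.behavior) dμ ∧
        ∀ ν, IsStationary (p.chain p.behavior) ν → ν = dμ) ∧
      (∃ C χ : ℝ, GeometricallyErgodic (p.chain p.behavior) dμ C χ) ∧
      -- the fixed point is well defined
      IsEmphasisLimit.{w} p dμ m ∧
      IsUnit (p.keyMatrix m).det ∧
      (∃ κ : ℝ, p.IsMonotonicityConst m κ) ∧
      (∃ L : ℝ, p.IsLipschitzConst m L) ∧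
      -- the convergence rate and the sample complexity
      ∀ CM χ : ℝ, GeometricallyErgodic (p.chain p.behavior) dμ CM χ →
      ∀ κ L : ℝ, p.IsMonotonicityConst m κ → p.IsLipschitzConst m L →
      ∀ ξ aLam : ℝ, ξ = max p.γ χ → aLam = 1 / (Real.logb (1 / ξ) p.ratioMax + 1) →
      -- `b T` is `log T / (log ρ_max + log (1/ξ))` up to a bounded error, for instance
      -- `max b₀ ⌈log T / (log ρ_max + log (1/ξ))⌉` with a fixed `b₀` (take `K = max b₀ 1`)
      ∀ K : ℝ, ∃ C : ℝ, ∀ b : ℕ → ℕ,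
        (∀ T : ℕ, 1 ≤ T →
          |(b T : ℝ) - Real.log T / (Real.log p.ratioMax + Real.log (1 / ξ))| ≤ K) →
        (∀ T : ℕ, 1 ≤ T →
          MeanSquareErrorLE.{w} p m κ L (b T) T (C / (T : ℝ) ^ aLam)) ∧
        (∀ ε : ℝ, 0 < ε → ε ≤ 1 → ∃ T : ℕ, 1 ≤ T ∧
          MeanSquareErrorLE.{w} p m κ L (b T) T ε ∧
          (T : ℝ) * ((b T : ℝ) + 1) ≤
            C * (1 / ε) ^ (1 / aLam) * (1 + Real.log (1 / ε))) := by
  have hP := p.chain_mem_rowStochastic p.behavior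
  obtain ⟨dμ, hst⟩ := exists_isStationary hP hirr haper
  have hpos : ∀ i, 0 < dμ i := IsStationary.pos hst hirr
  have herg := exists_geometricallyErgodic hP hirr haper hst
  have hu := p.isUnit_keyMatrix dμ hφ hpos
  refine ⟨dμ, p.emphasisLimit dμ, ⟨hst, fun ν hν => IsStationary.unique hP hirr haper hν hst⟩,
    herg, ?_, hu, exists_isMonotonicityConst dμ hφ hpos, exists_isLipschitzConst _, ?_⟩
  · obtain ⟨C, χ, hge⟩ := herg
    exact isEmphasisLimit_emphasisLimit hcov hge hpos
  intro CM χ hge κ L hκ hL ξ α hξ hα K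
  obtain ⟨C₁, hC₁, hmse⟩ := exists_meanSquareErrorLE.{w} hcov hst hu hge hκ hL
  have hξ0 : 0 < ξ := hξ ▸ p.γ_pos.trans_le (le_max_left _ _)
  have hξ1 : ξ < 1 := hξ ▸ max_lt p.γ_lt_one hge.2.2.1
  have hρ := one_le_ratioMax hcov
  have hlx : 0 < Real.log (1 / ξ) := Real.log_pos ((one_lt_div hξ0).2 hξ1)
  have hlr : 0 ≤ Real.log p.ratioMax := Real.log_nonneg hρ
  have hα0 : 0 < α := by
    rw [hα, Real.logb]
    positivity
  set C₀ := C₁ * (Real.exp (Real.log (1 / ξ) * K) + Real.exp (Real.log p.ratioMax * K))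
  have hC₀ : 0 ≤ C₀ := by positivity
  obtain ⟨C₂, hC₂⟩ := exists_sample_complexity hC₀ hα0 (by linarith :
    0 < Real.log p.ratioMax + Real.log (1 / ξ)) K
  -- Both constants are fixed before the period lengths; the accuracy is reached using the rate
  -- constant `C₀`, and `C₂` enters only the sample count.
  refine ⟨max C₀ C₂, fun b hb => ?_⟩
  have hrate : ∀ T : ℕ, 1 ≤ T →
      MeanSquareErrorLE.{w} p (p.emphasisLimit dμ) κ L (b T) T (C₀ / (T : ℝ) ^ α) := by
    intro T hT
    refine (hmse (b T) T hT).mono ?_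
    rw [← hξ, mul_div_assoc]
    exact mul_le_mul_of_nonneg_left (pow_add_pow_div_le hξ0 hξ1 hρ hα hT (hb T hT)) hC₁
  refine ⟨fun T hT => (hrate T hT).mono ?_, fun ε hε hε1 => ?_⟩
  · exact div_le_div_of_nonneg_right (le_max_left _ _) (by positivity)
  · obtain ⟨T, hT, hTε, hTb⟩ := hC₂ ε hε hε1
    refine ⟨T, hT, (hrate T hT).mono hTε, (hTb (b T) (hb T hT)).trans ?_⟩
    have : 0 ≤ Real.log (1 / ε) := Real.log_nonneg ((one_le_div hε).2 hε1)
    gcongr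
    exact le_max_right _ _
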